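/- Let $M>0$. Let $\rho_1,\sigma_1\in H^2(-1,0)$ and $\rho_2,\sigma_2\in H^2(0,1)$ be uniformly positive real functions, and let $q_1\in L^1(-1,0)$ and $q_2\in L^1(0,1)$ be nonnegative. For $m\ge 0$ consider the eigenvalue problem $$ (P_m)\qquad \begin{cases} -(\sigma_1u')'+q_1u=\lambda\rho_1u & \text{on }(-1,0),\\ -(\sigma_2v')'+q_2v=\lambda\rho_2v & \text{on }(0,1),\\ u(-1)=v(1)=0,\quad u(0)=v(0),\\ \sigma_1(0)u'(0)-\sigma_2(0)v'(0)=\lambda\, m\, u(0), \end{cases} $$ and the two Dirichlet problems $$-(\sigma_1y')'+q_1y=\lambda\rho_1y\ \text{ on }(-1,0),\quad y(-1)=y(0)=0,$$ $$-(\sigma_2y')'+q_2y=\lambda\rho_2y\ \text{ on }(0,1),\quad y(0)=y(1)=0.$$ Here a solution of an equation $-(\sigma y')'+qy=\lambda\rho y$ on an interval is a real function $y$ that is differentiable up to the end points, with $\sigma y'$ absolutely continuous, satisfying the equation almost everywhere; $\lambda$ is real. Then the eigenvalues of $(P_M)$, those of $(P_0)$, and those of the two Dirichlet problems taken together can be arranged,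 each repeated according to multiplicity (for the Dirichlet problems: the sum of its multiplicities in the two problems), in nondecreasing infinite sequences $(\lambda_n)_{n\ge1}$, $(\lambda'_n)_{n\ge1}$ and $(\mu_n)_{n\ge1}$ respectively, and $$\lambda_1<\lambda_1'<\mu_1 .$$ For every $n\ge1$: * if $\mu_n\neq\mu_{n+1}$, then $\mu_n<\lambda_{n+1}<\lambda'_{n+1}<\mu_{n+1}$; * if $\mu_n=\mu_{n+1}$, then $\mu_n=\lambda_{n+1}=\lambda'_{n+1}$. Moreover, as $n\to\infty$, $$\lambda_n\sim\left(\frac{n\pi}{\gamma_1+\gamma_2}\right)^2,\qquad \gamma_1=\int_{-1}^0\sqrt{\frac{\rho_1(x)}{\sigma_1(x)}}\,dx,\quad \gamma_2=\int_0^1\sqrt{\frac{\rho_2(x)}{\sigma_2(x)}}\,dx .$$ -/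

import Mathlib

open MeasureTheory Set Filter Topology Asymptotics

noncomputable section

/-- `f` is (the continuous representative of) an element of the Sobolev space `H²(a, b)`:
it is differentiable on `[a, b]` (one-sidedly at the end points), its derivative `g` is absolutely
continuous on `[a, b]`, and the almost everywhere derivative of `g` is square integrable. -/
def MemH2 (f : ℝ → ℝ) (a b : ℝ) : Prop :=
  ∃ g : ℝ → ℝ, (∀ x ∈ Icc a b, HasDerivWithinAt f (g x) (Icc a b) x) ∧
    AbsolutelyContinuousOnInterval g a b ∧ MemLp (deriv g) 2 (volume.restrict (Ioo a b))

/-- The standing assumptions on the density `ρ`, the tension `σ` and the potential `q` of a string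
occupying `[a, b]`: `ρ, σ ∈ H²(a, b)` are uniformly positive, and `q ∈ L¹(a, b)` is nonnegative. -/
structure IsStringCoeff (a b : ℝ) (ρ σ q : ℝ → ℝ) : Prop where
  memH2_density : MemH2 ρ a b
  memH2_tension : MemH2 σ a b
  density_pos : ∃ c > 0, ∀ x ∈ Icc a b, c ≤ ρ x
  tension_pos : ∃ c > 0, ∀ x ∈ Icc a b, c ≤ σ x
  integrable_potential : IntegrableOn q (Ioo a b)
  potential_nonneg : ∀ᵐ x ∂volume.restrict (Ioo a b), 0 ≤ q x

/-- `u` solves `-(σ u')' + q u = l ρ u` on `(a, b)`: `u` is differentiable on `[a, b]` (one-sidedly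
at the end points), `σ u'` is absolutely continuous on `[a, b]`, and the equation holds almost
everywhere, in the form `(σ u')' = q u - l ρ u`. A function on `[a, b]` is represented by its
extension by zero to `ℝ`, so that distinct elements are distinct functions on `[a, b]`. -/
def IsStringSolution (a b : ℝ) (ρ σ q : ℝ → ℝ) (l : ℝ) (u : ℝ → ℝ) : Prop :=
  (∀ x, x ∉ Icc a b → u x = 0) ∧
  ∃ u' : ℝ → ℝ, (∀ x ∈ Icc a b, HasDerivWithinAt u (u' x) (Icc a b) x) ∧
    AbsolutelyContinuousOnInterval (fun x => σ x * u' x) a b ∧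
    ∀ᵐ x ∂volume.restrict (Ioo a b),
      HasDerivAt (fun y => σ y * u' y) (q x * u x - l * (ρ x * u x)) x

/-- The vector space of solutions of `-(σ u')' + q u = l ρ u` on `(a, b)`. -/
def stringSolutions (a b : ℝ) (ρ σ q : ℝ → ℝ) (l : ℝ) : Submodule ℝ (ℝ → ℝ) where
  carrier := {u | IsStringSolution a b ρ σ q l u}
  zero_mem' := by
    refine ⟨fun _ _ => rfl, 0, fun x _ => hasDerivWithinAt_const x _ (0 : ℝ), ?_, ?_⟩
    · have h : LipschitzOnWith 0 (fun _ : ℝ => (0 : ℝ)) (uIcc a b) := by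
        intro x _ y _
        simp
      simpa using h.absolutelyContinuousOnInterval
    · refine Eventually.of_forall fun x => ?_
      simpa using hasDerivAt_const x (0 : ℝ)
  add_mem' := by
    rintro u v ⟨hu0, u', hu, hua, hue⟩ ⟨hv0, v', hv, hva, hve⟩
    have e : (fun x => σ x * (u' + v') x) = (fun x => σ x * u' x) + fun x => σ x * v' x := by
      funext x
      simp [mul_add]
    refine ⟨fun x hx => by simp [hu0 x hx, hv0 x hx], u' + v',
      fun x hx => (hu x hx).add (hv x hx), ?_, ?_⟩
    · rw [e]
      exact hua.add hva
    · filter_upwards [hue, hve] with x h1 h2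
      rw [e]
      refine (h1.add h2).congr_deriv ?_
      simp only [Pi.add_apply]
      ring
  smul_mem' := by
    rintro c u ⟨hu0, u', hu, hua, hue⟩
    have e : (fun x => σ x * (c • u') x) = fun x => c * (σ x * u' x) := by
      funext x
      simp only [Pi.smul_apply, smul_eq_mul]
      ring
    refine ⟨fun x hx => by simp [hu0 x hx], c • u', fun x hx => (hu x hx).const_smul c, ?_, ?_⟩
    · rw [e]
      exact hua.const_mul c
    · filter_upwards [hue] with x h1
      rw [e]
      refine (h1.const_mul c).congr_deriv ?_
      simp only [Pi.smul_apply, smul_eq_mul]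
      ring

/-- The eigenspace for the value `l` of the Dirichlet problem
`-(σ y')' + q y = l ρ y` on `(a, b)`, `y(a) = y(b) = 0`. -/
def dirichletEigenspace (a b : ℝ) (ρ σ q : ℝ → ℝ) (l : ℝ) : Submodule ℝ (ℝ → ℝ) where
  carrier := {y | y ∈ stringSolutions a b ρ σ q l ∧ y a = 0 ∧ y b = 0}
  zero_mem' := ⟨Submodule.zero_mem _, rfl, rfl⟩
  add_mem' := by
    rintro u v ⟨hu, hua, hub⟩ ⟨hv, hva, hvb⟩
    exact ⟨Submodule.add_mem _ hu hv, by simp [hua, hva], by simp [hub, hvb]⟩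
  smul_mem' := by
    rintro c u ⟨hu, hua, hub⟩
    exact ⟨Submodule.smul_mem _ c hu, by simp [hua], by simp [hub]⟩

lemma stringSolutions_differentiableWithinAt {a b : ℝ} {ρ σ q : ℝ → ℝ} {l : ℝ} {u : ℝ → ℝ}
    (hu : u ∈ stringSolutions a b ρ σ q l) {x : ℝ} (hx : x ∈ Icc a b) :
    DifferentiableWithinAt ℝ u (Icc a b) x := by
  obtain ⟨_, u', h, _⟩ := hu
  exact (h x hx).differentiableWithinAt

/-- The eigenspace for the value `l` of the problem of two strings on `[-1, 0]` and `[0, 1]`, joined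
at `0` by a point mass `M`:
`-(σ₁ u')' + q₁ u = l ρ₁ u` on `(-1, 0)`, `-(σ₂ v')' + q₂ v = l ρ₂ v` on `(0, 1)`,
`u(-1) = v(1) = 0`, `u(0) = v(0)`, `σ₁(0) u'(0⁻) - σ₂(0) v'(0⁺) = l M u(0)`. -/
def joinedEigenspace (ρ₁ σ₁ q₁ ρ₂ σ₂ q₂ : ℝ → ℝ) (M l : ℝ) :
    Submodule ℝ ((ℝ → ℝ) × (ℝ → ℝ)) where
  carrier := {p | p.1 ∈ stringSolutions (-1) 0 ρ₁ σ₁ q₁ l ∧ p.2 ∈ stringSolutions 0 1 ρ₂ σ₂ q₂ l ∧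
    p.1 (-1) = 0 ∧ p.2 1 = 0 ∧ p.1 0 = p.2 0 ∧
    σ₁ 0 * derivWithin p.1 (Icc (-1) 0) 0 - σ₂ 0 * derivWithin p.2 (Icc 0 1) 0 = l * M * p.1 0}
  zero_mem' := by
    refine ⟨Submodule.zero_mem _, Submodule.zero_mem _, rfl, rfl, rfl, ?_⟩
    simp [derivWithin_zero]
  add_mem' := by
    rintro p r ⟨hp1, hp2, hpa, hpb, hpc, hpd⟩ ⟨hr1, hr2, hra, hrb, hrc, hrd⟩
    refine ⟨Submodule.add_mem _ hp1 hr1, Submodule.add_mem _ hp2 hr2, by simp [hpa, hra],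
      by simp [hpb, hrb], by simp [hpc, hrc], ?_⟩
    have h1 : (0 : ℝ) ∈ Icc (-1 : ℝ) 0 := by simp
    have h2 : (0 : ℝ) ∈ Icc (0 : ℝ) 1 := by simp
    have d1 := derivWithin_add (stringSolutions_differentiableWithinAt hp1 h1)
      (stringSolutions_differentiableWithinAt hr1 h1)
    have d2 := derivWithin_add (stringSolutions_differentiableWithinAt hp2 h2)
      (stringSolutions_differentiableWithinAt hr2 h2)
    simp only [Prod.fst_add, Prod.snd_add, Pi.add_apply]
    rw [d1, d2]
    linear_combination hpd + hrd
  smul_mem' := by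
    rintro c p ⟨hp1, hp2, hpa, hpb, hpc, hpd⟩
    refine ⟨Submodule.smul_mem _ c hp1, Submodule.smul_mem _ c hp2, by simp [hpa],
      by simp [hpb], by simp [hpc], ?_⟩
    have h1 : (0 : ℝ) ∈ Icc (-1 : ℝ) 0 := by simp
    have h2 : (0 : ℝ) ∈ Icc (0 : ℝ) 1 := by simp
    have d1 := derivWithin_const_smul c (stringSolutions_differentiableWithinAt hp1 h1)
    have d2 := derivWithin_const_smul c (stringSolutions_differentiableWithinAt hp2 h2)
    simp only [Prod.smul_fst, Prod.smul_snd, Pi.smul_apply, smul_eq_mul]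
    rw [d1, d2]
    simp only [smul_eq_mul]
    linear_combination c * hpd

/-- The dimension of a real vector space, as an element of `ℕ∞` (`⊤` for infinite dimension). -/
def edim (V : Type*) [AddCommGroup V] [Module ℝ V] : ℕ∞ :=
  Cardinal.toENat (Module.rank ℝ V)

/-- The sequence `s 0 ≤ s 1 ≤ s 2 ≤ …` lists exactly the real numbers `x` with `m x ≠ 0`, each `x`
being repeated `m x` times. (The listing starts at index `0`.) Such a sequence is unique. -/
def IsListing (m : ℝ → ℕ∞) (s : ℕ → ℝ) : Prop :=
  Monotone s ∧ ∀ x : ℝ, {n : ℕ | s n = x}.encard = m x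

/-- The optical length `∫_a^b √(ρ/σ)` of a string. -/
def opticalLength (a b : ℝ) (ρ σ : ℝ → ℝ) : ℝ :=
  ∫ x in a..b, √(ρ x / σ x)

end

/-! Each string is followed from its fixed outer end to the junction by a Prüfer angle: writing `y =
r sin θ` and `σ y' = r cos θ` reduces the equation to a scalar first order equation for `θ`. Let
`α(l)` and `β(l)` be the angles reached at `0` from `-1` and from `1`, both starting at `0`, the
second string being reflected. They are continuous, positive and strictly increasing in `l`, lie
below `π/2` at `l = 0` because `q ≥ 0`, and equal `√l` times the optical length up to a bounded
error (`angle_lt_angle`, `continuous_angle`, `angle_zero_lt`, `exists_abs_angle_sub_le`).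

A Dirichlet eigenvalue is a point where `α` or `β` is a multiple of `π`, so `⌊α/π⌋ + ⌊β/π⌋` counts
those that are at most `l`. In the joined problem the mass shears the left data `(cos α, sin α)`
into `(cos α - l M sin α, sin α)`, which has an angle `τ` (`massAngle`). Matching with the right
data means `sin (τ + β) = 0`, and the eigenspace is then a line (`edim_joined`). Hence, counting
from `1`, the `n`-th eigenvalues with and without mass are the points where `τ + β`, respectively `α
+ β`, equals `nπ`.

The interlacing is now arithmetic. The shear fixes the multiples of `π` and, for `l > 0`, strictly
advances every other angle. So `τ/π` and `α/π` have the same integer part, and the mass lowers an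
eigenvalue strictly unless `α` is a multiple of `π` there. When two angles add up to `nπ`, either
both are multiples of `π`, and the point is an eigenvalue of both Dirichlet problems, or neither is,
and exactly `n - 1` Dirichlet eigenvalues lie below the point and none at it (`angles_of_add_eq`).
The asymptotics follow from `τ + β = √l (γ₁ + γ₂) + O(1)`. -/

/-! ### Absolutely continuous functions with a given almost everywhere derivative -/

/-- `F` is absolutely continuous on `[a, b]` with almost everywhere derivative `f`. -/
def HasACDeriv (F f : ℝ → ℝ) (a b : ℝ) : Prop :=
  AbsolutelyContinuousOnInterval F a b ∧ ∀ᵐ x ∂volume.restrict (Ioo a b), HasDerivAt F (f x) x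

lemma AbsolutelyContinuousOnInterval.congr {F G : ℝ → ℝ} {a b : ℝ}
    (hF : AbsolutelyContinuousOnInterval F a b) (h : ∀ x ∈ uIcc a b, F x = G x) :
    AbsolutelyContinuousOnInterval G a b := by
  rw [absolutelyContinuousOnInterval_iff] at hF ⊢
  intro ε hε
  obtain ⟨δ, hδ, H⟩ := hF ε hε
  refine ⟨δ, hδ, fun E hE hEδ => ?_⟩
  have := H E hE hEδ
  rwa [Finset.sum_congr rfl fun i hi => by rw [h _ (hE.1 i hi).1, h _ (hE.1 i hi).2]] at this

lemma LipschitzOnWith.comp_absolutelyContinuousOnInterval {g F : ℝ → ℝ} {a b : ℝ} {K : NNReal}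
    {s : Set ℝ} (hg : LipschitzOnWith K g s) (hF : AbsolutelyContinuousOnInterval F a b)
    (hs : ∀ x ∈ uIcc a b, F x ∈ s) :
    AbsolutelyContinuousOnInterval (fun x => g (F x)) a b := by
  rw [absolutelyContinuousOnInterval_iff] at hF ⊢
  intro ε hε
  obtain ⟨δ, hδ, H⟩ := hF (ε / (K + 1)) (by positivity)
  refine ⟨δ, hδ, fun E hE hEδ => ?_⟩
  have h1 := H E hE hEδ
  calc _ ≤ ∑ i ∈ Finset.range E.1, (K + 1) * dist (F (E.2 i).1) (F (E.2 i).2) := by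
        refine Finset.sum_le_sum fun i hi => ?_
        have := hg.dist_le_mul _ (hs _ (hE.1 i hi).1) _ (hs _ (hE.1 i hi).2)
        nlinarith [dist_nonneg (x := F (E.2 i).1) (y := F (E.2 i).2)]
    _ = (K + 1) * ∑ i ∈ Finset.range E.1, dist (F (E.2 i).1) (F (E.2 i).2) := by
        rw [Finset.mul_sum]
    _ < ε := by
        rw [lt_div_iff₀ (by positivity)] at h1
        linarith

namespace HasACDeriv

variable {F G f g : ℝ → ℝ} {a b : ℝ}

lemma continuousOn (hab : a ≤ b) (h : HasACDeriv F f a b) : ContinuousOn F (Icc a b) := by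
  simpa [uIcc_of_le hab] using h.1.continuousOn

lemma congr_left (hab : a ≤ b) (h : HasACDeriv F f a b) (e : ∀ x ∈ Icc a b, F x = G x) :
    HasACDeriv G f a b := by
  refine ⟨h.1.congr (by simpa [uIcc_of_le hab] using e), ?_⟩
  filter_upwards [h.2, ae_restrict_mem measurableSet_Ioo] with x hx hm
  refine hx.congr_of_eventuallyEq ?_
  filter_upwards [isOpen_Ioo.mem_nhds hm] with y hy using (e y (Ioo_subset_Icc_self hy)).symm

lemma congr_right_ae (h : HasACDeriv F f a b) (e : ∀ᵐ x ∂volume.restrict (Ioo a b), f x = g x) :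
    HasACDeriv F g a b :=
  ⟨h.1, by filter_upwards [h.2, e] with x hx h1 using h1 ▸ hx⟩

lemma congr_right (h : HasACDeriv F f a b) (e : ∀ x ∈ Ioo a b, f x = g x) :
    HasACDeriv F g a b :=
  h.congr_right_ae (by filter_upwards [ae_restrict_mem measurableSet_Ioo] with x hx using e x hx)

lemma ae_eq_deriv (h : HasACDeriv F f a b) : deriv F =ᵐ[volume.restrict (Ioo a b)] f := by
  filter_upwards [h.2] with x hx using hx.deriv

lemma integrableOn (hab : a ≤ b) (h : HasACDeriv F f a b) : IntegrableOn f (Ioo a b) := by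
  have h1 := h.1.intervalIntegrable_deriv
  rw [intervalIntegrable_iff_integrableOn_Ioo_of_le hab] at h1
  exact h1.congr h.ae_eq_deriv

lemma mono {c d : ℝ} (h : HasACDeriv F f a b) (hac : a ≤ c) (hcd : c ≤ d) (hdb : d ≤ b) :
    HasACDeriv F f c d := by
  refine ⟨h.1.mono ?_, ae_restrict_of_ae_restrict_of_subset (Ioo_subset_Ioo hac hdb) h.2⟩
  rw [uIcc_of_le hcd, uIcc_of_le (hac.trans (hcd.trans hdb))]
  exact Icc_subset_Icc hac hdb

lemma integral_eq_sub (hab : a ≤ b) (h : HasACDeriv F f a b) : ∫ x in a..b, f x = F b - F a := by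
  rw [← h.1.integral_deriv_eq_sub, intervalIntegral.integral_of_le hab,
    intervalIntegral.integral_of_le hab, integral_Ioc_eq_integral_Ioo,
    integral_Ioc_eq_integral_Ioo]
  exact integral_congr_ae h.ae_eq_deriv.symm

lemma eq_add_integral (h : HasACDeriv F f a b) {x : ℝ} (hx : x ∈ Icc a b) :
    F x = F a + ∫ t in a..x, f t := by
  rw [(h.mono le_rfl hx.1 hx.2).integral_eq_sub hx.1]
  ring

lemma add (hF : HasACDeriv F f a b) (hG : HasACDeriv G g a b) :
    HasACDeriv (fun x => F x + G x) (fun x => f x + g x) a b :=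
  ⟨hF.1.add hG.1, by filter_upwards [hF.2, hG.2] with x h1 h2 using h1.add h2⟩

lemma neg (hF : HasACDeriv F f a b) : HasACDeriv (fun x => -F x) (fun x => -f x) a b :=
  ⟨hF.1.neg, by filter_upwards [hF.2] with x h1 using h1.neg⟩

lemma sub (hF : HasACDeriv F f a b) (hG : HasACDeriv G g a b) :
    HasACDeriv (fun x => F x - G x) (fun x => f x - g x) a b :=
  ⟨hF.1.sub hG.1, by filter_upwards [hF.2, hG.2] with x h1 h2 using h1.sub h2⟩

lemma mul (hF : HasACDeriv F f a b) (hG : HasACDeriv G g a b) :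
    HasACDeriv (fun x => F x * G x) (fun x => f x * G x + F x * g x) a b :=
  ⟨hF.1.mul hG.1, by filter_upwards [hF.2, hG.2] with x h1 h2 using h1.mul h2⟩

lemma comp {φ φ' : ℝ → ℝ} (hF : HasACDeriv F f a b)
    (hφ : ∀ y, HasDerivAt φ (φ' y) y) (hφ' : Continuous φ') :
    HasACDeriv (fun x => φ (F x)) (fun x => φ' (F x) * f x) a b := by
  refine ⟨?_, by filter_upwards [hF.2] with x h1 using (hφ (F x)).comp x h1⟩
  obtain ⟨C, hC⟩ := hF.1.exists_bound
  have hd : ContDiff ℝ 1 φ := contDiff_one_iff_deriv.2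
    ⟨fun y => (hφ y).differentiableAt, by rwa [funext fun y => (hφ y).deriv]⟩
  obtain ⟨K, hK⟩ := (hd.contDiffOn (s := Icc (-C) C)).exists_lipschitzOnWith (by decide)
    (convex_Icc _ _) isCompact_Icc
  exact hK.comp_absolutelyContinuousOnInterval hF.1 fun x hx => abs_le.1 (hC x hx)

lemma of_integral (hab : a ≤ b) (hf : IntegrableOn f (Ioo a b)) (c : ℝ) :
    HasACDeriv (fun x => c + ∫ t in a..x, f t) f a b := by
  have hi : IntervalIntegrable f volume a b :=
    (intervalIntegrable_iff_integrableOn_Ioo_of_le hab).2 hf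
  have hc : AbsolutelyContinuousOnInterval (fun _ : ℝ => c) a b :=
    (LipschitzOnWith.absolutelyContinuousOnInterval (K := 0) (by intro x _ y _; simp))
  refine ⟨hc.add (hi.absolutelyContinuousOnInterval_intervalIntegral left_mem_uIcc), ?_⟩
  rw [ae_restrict_iff' measurableSet_Ioo]
  filter_upwards [hi.ae_hasDerivAt_integral] with x hx hm
  have := hx (by rw [uIcc_of_le hab]; exact Ioo_subset_Icc_self hm) a left_mem_uIcc
  simpa using this.const_add c

lemma of_hasDerivWithinAt (hab : a < b)
    (hF : ∀ x ∈ Icc a b, HasDerivWithinAt F (f x) (Icc a b) x) (hf : ContinuousOn f (Icc a b)) :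
    HasACDeriv F f a b := by
  obtain ⟨C, hC⟩ := isCompact_Icc.exists_bound_of_continuousOn hf
  constructor
  · have hL : LipschitzOnWith (Real.toNNReal C) F (Icc a b) := by
      refine (convex_Icc a b).lipschitzOnWith_of_nnnorm_hasDerivWithin_le hF fun x hx => ?_
      rw [← NNReal.coe_le_coe, coe_nnnorm]
      exact (hC x hx).trans (Real.le_coe_toNNReal C)
    rw [← uIcc_of_le hab.le] at hL
    exact hL.absolutelyContinuousOnInterval
  · filter_upwards [ae_restrict_mem measurableSet_Ioo] with x hx
    exact (hF x (Ioo_subset_Icc_self hx)).hasDerivAt (Icc_mem_nhds hx.1 hx.2)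

lemma hasDerivWithinAt (hab : a < b) (h : HasACDeriv F f a b) (hf : ContinuousOn f (Icc a b))
    {x : ℝ} (hx : x ∈ Icc a b) : HasDerivWithinAt F (f x) (Icc a b) x := by
  have hcont : ContinuousOn f (uIcc a b) := by rwa [uIcc_of_le hab.le]
  have hi : IntervalIntegrable f volume a b := hcont.intervalIntegrable
  have h1 : HasDerivWithinAt (fun u => F a + ∫ t in a..u, f t) (f x) (Icc a b) x := by
    have : Fact (x ∈ Icc a b) := ⟨hx⟩
    have hix : IntervalIntegrable f volume a x := hi.mono_set (by
      rw [uIcc_of_le hab.le, uIcc_of_le hx.1]; exact Icc_subset_Icc_right hx.2)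
    exact (intervalIntegral.integral_hasDerivWithinAt_right hix (s := Icc a b) (t := Icc a b)
      (hf.stronglyMeasurableAtFilter_nhdsWithin measurableSet_Icc x) (hf x hx)).const_add _
  exact h1.congr (fun y hy => h.eq_add_integral hy) (h.eq_add_integral hx)

lemma monotoneOn (h : HasACDeriv F f a b) (hf : ∀ᵐ x ∂volume.restrict (Ioo a b), 0 ≤ f x) :
    MonotoneOn F (Icc a b) := by
  intro x hx y hy hxy
  have h1 := (h.mono hx.1 hxy hy.2).integral_eq_sub hxy
  have h2 : 0 ≤ ∫ t in x..y, f t := by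
    rw [intervalIntegral.integral_of_le hxy, integral_Ioc_eq_integral_Ioo]
    exact integral_nonneg_of_ae
      (ae_restrict_of_ae_restrict_of_subset (Ioo_subset_Ioo hx.1 hy.2) hf)
  linarith

lemma eq_left (h : HasACDeriv F f a b) (hf : ∀ᵐ x ∂volume.restrict (Ioo a b), f x = 0)
    {x : ℝ} (hx : x ∈ Icc a b) : F x = F a := by
  have ha : a ∈ Icc a b := ⟨le_rfl, hx.1.trans hx.2⟩
  have h1 := h.monotoneOn (by filter_upwards [hf] with y hy using hy.ge) ha hx hx.1
  have h2 := h.neg.monotoneOn (by filter_upwards [hf] with y hy; simp [hy]) ha hx hx.1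
  simp only at h2
  linarith

/-- Comparison of an absolutely continuous function with a primitive of a bound of its
derivative. -/
lemma abs_sub_le (hF : HasACDeriv F f a b) (hG : HasACDeriv G g a b)
    (hfg : ∀ᵐ x ∂volume.restrict (Ioo a b), |f x| ≤ g x) {x : ℝ} (hx : x ∈ Icc a b) :
    |F x - F a| ≤ G x - G a := by
  have ha : a ∈ Icc a b := ⟨le_rfl, hx.1.trans hx.2⟩
  have h1 := (hG.sub hF).monotoneOn
    (by filter_upwards [hfg] with y hy; linarith [(abs_le.1 hy).2]) ha hx hx.1
  have h2 := (hG.add hF).monotoneOn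
    (by filter_upwards [hfg] with y hy; linarith [(abs_le.1 hy).1]) ha hx hx.1
  simp only at h1 h2
  rw [abs_le]
  constructor <;> linarith

lemma ae_restrict_Ioo_neg {p : ℝ → Prop} (h : ∀ᵐ x ∂volume.restrict (Ioo a b), p x) :
    ∀ᵐ x ∂volume.restrict (Ioo (-b) (-a)), p (-x) := by
  have h1 : MeasurePreserving (fun x : ℝ => -x) (volume.restrict (Ioo (-b) (-a)))
      (volume.restrict (Ioo a b)) := by
    have := (Measure.measurePreserving_neg (volume : Measure ℝ)).restrict_preimage
      (s := Ioo a b) measurableSet_Ioo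
    simpa using this
  exact h1.quasiMeasurePreserving.ae h

lemma integrableOn_Ioo_neg (h : IntegrableOn f (Ioo a b)) :
    IntegrableOn (fun x => f (-x)) (Ioo (-b) (-a)) := by
  have h1 : MeasurePreserving (fun x : ℝ => -x) (volume.restrict (Ioo (-b) (-a)))
      (volume.restrict (Ioo a b)) := by
    have := (Measure.measurePreserving_neg (volume : Measure ℝ)).restrict_preimage
      (s := Ioo a b) measurableSet_Ioo
    simpa using this
  exact h1.integrable_comp_of_integrable h

lemma comp_neg (hab : a ≤ b) (h : HasACDeriv F f a b) :
    HasACDeriv (fun x => F (-x)) (fun x => -f (-x)) (-b) (-a) := by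
  refine ⟨?_, ?_⟩
  -- The reflected function is recognised as a primitive of its derivative, which yields absolute
  -- continuity.
  · have h1 := (of_integral (neg_le_neg hab) (integrableOn_Ioo_neg (h.integrableOn hab)).neg
      (F b)).1
    refine h1.congr fun x hx => ?_
    rw [uIcc_of_le (neg_le_neg hab)] at hx
    have hx1 : -x ∈ Icc a b := ⟨by linarith [hx.2], by linarith [hx.1]⟩
    have e := (h.mono hx1.1 hx1.2 le_rfl).integral_eq_sub hx1.2
    simp only [Pi.neg_apply, intervalIntegral.integral_neg,
      intervalIntegral.integral_comp_neg, neg_neg, e]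
    ring
  · filter_upwards [ae_restrict_Ioo_neg h.2] with x hx
    simpa [Function.comp_def] using hx.comp x (hasDerivAt_neg x)

/-- Variation of constants for the linear equation `d' = A d + B`. -/
lemma exp_neg_mul {d A B E : ℝ → ℝ}
    (hd : HasACDeriv d (fun x => A x * d x + B x) a b) (hE : HasACDeriv E A a b) :
    HasACDeriv (fun x => Real.exp (-E x) * d x) (fun x => Real.exp (-E x) * B x) a b := by
  refine ((hE.neg.comp Real.hasDerivAt_exp Real.continuous_exp).mul hd).congr_right
    fun x _ => ?_
  ring

end HasACDeriv

/-! ### Existence for the angular equation -/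

lemma abs_sin_sq_sub_sin_sq_le (u v : ℝ) :
    |Real.sin u ^ 2 - Real.sin v ^ 2| ≤ |u - v| := by
  have h : Real.sin u ^ 2 - Real.sin v ^ 2 = Real.sin (u - v) * Real.sin (u + v) := by
    rw [Real.sin_sub, Real.sin_add]
    nlinarith [Real.sin_sq_add_cos_sq u, Real.sin_sq_add_cos_sq v]
  rw [h, abs_mul]
  have h1 : |Real.sin (u - v)| ≤ |u - v| := Real.abs_sin_le_abs
  nlinarith [Real.abs_sin_le_one (u + v), abs_nonneg (Real.sin (u - v)),
    abs_nonneg (Real.sin (u + v))]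

lemma MeasureTheory.IntegrableOn.mul_continuousOn_Icc {g c : ℝ → ℝ} {a b : ℝ}
    (hg : IntegrableOn g (Ioo a b)) (hc : ContinuousOn c (Icc a b)) :
    IntegrableOn (fun x => g x * c x) (Ioo a b) :=
  (IntegrableOn.mul_continuousOn (by rwa [integrableOn_Icc_iff_integrableOn_Ioo]) hc
    isCompact_Icc).mono_set Ioo_subset_Icc_self

lemma ContinuousOn.integrableOn_Ioo {c : ℝ → ℝ} {a b : ℝ} (hc : ContinuousOn c (Icc a b)) :
    IntegrableOn c (Ioo a b) :=
  hc.integrableOn_Icc.mono_set Ioo_subset_Icc_self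

/-- Carathéodory existence for the angular equation `θ' = h + g sin² θ` with integrable
coefficients. -/
theorem exists_hasACDeriv_angle {h g : ℝ → ℝ} {a b : ℝ} (hab : a ≤ b)
    (hh : IntegrableOn h (Ioo a b)) (hg : IntegrableOn g (Ioo a b)) (α : ℝ) :
    ∃ θ : ℝ → ℝ, HasACDeriv θ (fun x => h x + g x * Real.sin (θ x) ^ 2) a b ∧ θ a = α := by
  set K : ℝ → ℝ := fun x => 0 + ∫ t in a..x, |g t| with hK
  have K_ac : HasACDeriv K (fun x => |g x|) a b := HasACDeriv.of_integral hab hg.abs 0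
  have K_cont : ContinuousOn K (Icc a b) := K_ac.continuousOn hab
  -- Picard iteration in a weighted norm: the unknown is `η = exp (-2K) θ`, with `K` a primitive of
  -- `|g|`. As `|g| exp (2K)` has primitive `exp (2K) / 2`, the iteration contracts by `1/2` on the
  -- whole interval, however large the integral of `|g|`.
  set V : C(Icc a b, ℝ) → ℝ → ℝ := fun η x => Real.exp (2 * K x) * IccExtend hab η x with hV
  set R : C(Icc a b, ℝ) → ℝ → ℝ := fun η x => h x + g x * Real.sin (V η x) ^ 2 with hR
  have V_cont (η : C(Icc a b, ℝ)) : ContinuousOn (V η) (Icc a b) := by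
    have : Continuous (IccExtend hab η) := η.continuous.Icc_extend'
    exact (Real.continuous_exp.comp_continuousOn (continuousOn_const.mul K_cont)).mul
      this.continuousOn
  have R_int (η : C(Icc a b, ℝ)) : IntegrableOn (R η) (Ioo a b) :=
    hh.add (hg.mul_continuousOn_Icc ((Real.continuous_sin.comp_continuousOn (V_cont η)).pow 2))
  set P : C(Icc a b, ℝ) → ℝ → ℝ := fun η x => α + ∫ t in a..x, R η t with hP
  have P_ac (η : C(Icc a b, ℝ)) : HasACDeriv (P η) (R η) a b :=
    HasACDeriv.of_integral hab (R_int η) α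
  let S : C(Icc a b, ℝ) → C(Icc a b, ℝ) := fun η =>
    ⟨fun x => Real.exp (-(2 * K x)) * P η x, by
      have := (Real.continuous_exp.comp_continuousOn (continuousOn_const.mul K_cont).neg).mul
        ((P_ac η).continuousOn hab) (s := Icc a b) (f := fun x => Real.exp (-(2 * K x)))
      exact continuousOn_iff_continuous_domRestrict.1 this⟩
  have S_contr : ContractingWith (1 / 2) S := by
    refine ⟨by rw [← NNReal.coe_lt_coe]; norm_num, LipschitzWith.of_dist_le_mul fun η ξ => ?_⟩
    have hD : (0 : ℝ) ≤ dist η ξ := dist_nonneg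
    rw [ContinuousMap.dist_le (by positivity)]
    intro x
    have G_ac : HasACDeriv (fun x => dist η ξ / 2 * Real.exp (2 * K x))
        (fun x => dist η ξ * (|g x| * Real.exp (2 * K x))) a b := by
      have h1 := K_ac.comp (φ := fun y => dist η ξ / 2 * Real.exp (2 * y))
        (φ' := fun y => dist η ξ * Real.exp (2 * y)) (fun y => by
          have := (((hasDerivAt_id y).const_mul 2).exp).const_mul (dist η ξ / 2)
          refine this.congr_deriv ?_
          simp only [id]
          ring) (by fun_prop)
      exact h1.congr_right fun x _ => by ring
    have key := ((P_ac η).sub (P_ac ξ)).abs_sub_le G_ac (by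
      filter_upwards [ae_restrict_mem measurableSet_Ioo] with t ht
      have e : R η t - R ξ t = g t * (Real.sin (V η t) ^ 2 - Real.sin (V ξ t) ^ 2) := by
        simp only [hR]; ring
      rw [e, abs_mul]
      have h1 := abs_sin_sq_sub_sin_sq_le (V η t) (V ξ t)
      have h2 : |V η t - V ξ t| ≤ Real.exp (2 * K t) * dist η ξ := by
        simp only [hV]
        rw [← mul_sub, abs_mul, abs_of_pos (Real.exp_pos _)]
        refine mul_le_mul_of_nonneg_left ?_ (Real.exp_pos _).le
        simp only [IccExtend, Function.comp]
        exact ContinuousMap.dist_apply_le_dist (f := η) (g := ξ) _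
      nlinarith [abs_nonneg (g t)]) x.2
    have Ka : K a = 0 := by simp [hK]
    have Pa (η : C(Icc a b, ℝ)) : P η a = α := by simp [hP]
    simp only [Pa, Ka, sub_self, mul_zero, Real.exp_zero, sub_zero, mul_one] at key
    have e : dist (S η x) (S ξ x) = Real.exp (-(2 * K x)) * |P η x - P ξ x| := by
      rw [Real.dist_eq]
      change |Real.exp (-(2 * K x)) * P η x - Real.exp (-(2 * K x)) * P ξ x| = _
      rw [← mul_sub, abs_mul, abs_of_pos (Real.exp_pos _)]
    rw [e]
    have h3 : Real.exp (-(2 * K x)) * Real.exp (2 * K x) = 1 := by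
      rw [← Real.exp_add]; simp
    calc _ ≤ Real.exp (-(2 * K x)) * (dist η ξ / 2 * Real.exp (2 * K x)) := by
          gcongr; linarith
      _ = dist η ξ / 2 * (Real.exp (-(2 * K x)) * Real.exp (2 * K x)) := by ring
      _ = _ := by rw [h3]; push_cast; ring
  have : Nonempty C(Icc a b, ℝ) := ⟨0⟩
  obtain ⟨η, hη⟩ : ∃ η, S η = η := ⟨_, S_contr.fixedPoint_isFixedPt⟩
  refine ⟨P η, (P_ac η).congr_right fun x hx => ?_, by simp [hP]⟩
  have hx' := Ioo_subset_Icc_self hx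
  have e : P η x = V η x := by
    have h1 : Real.exp (-(2 * K x)) * P η x = η ⟨x, hx'⟩ := congrArg (fun f => f ⟨x, hx'⟩) hη
    have h3 : Real.exp (2 * K x) * Real.exp (-(2 * K x)) = 1 := by
      rw [← Real.exp_add]; simp
    simp only [hV]
    rw [IccExtend_of_mem hab _ hx', ← h1, ← mul_assoc, h3, one_mul]
  rw [e]

/-! ### Coefficients and their reflection -/

/-- The properties of the coefficients of a string on `[a, b]` used below: `ρ, σ` are positive and
continuously differentiable on `[a, b]`, and `q` is integrable and nonnegative. -/
structure IsC1StringCoeff (a b : ℝ) (ρ σ q : ℝ → ℝ) : Prop where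
  lt : a < b
  density_pos : ∀ x ∈ Icc a b, 0 < ρ x
  tension_pos : ∀ x ∈ Icc a b, 0 < σ x
  density_deriv : ∃ ρ' : ℝ → ℝ, (∀ x ∈ Icc a b, HasDerivWithinAt ρ (ρ' x) (Icc a b) x) ∧
    ContinuousOn ρ' (Icc a b)
  tension_deriv : ∃ σ' : ℝ → ℝ, (∀ x ∈ Icc a b, HasDerivWithinAt σ (σ' x) (Icc a b) x) ∧
    ContinuousOn σ' (Icc a b)
  integrable_potential : IntegrableOn q (Ioo a b)
  potential_nonneg : ∀ᵐ x ∂volume.restrict (Ioo a b), 0 ≤ q x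

lemma MemH2.exists_deriv {f : ℝ → ℝ} {a b : ℝ} (hab : a ≤ b) (h : MemH2 f a b) :
    ∃ f' : ℝ → ℝ, (∀ x ∈ Icc a b, HasDerivWithinAt f (f' x) (Icc a b) x) ∧
      ContinuousOn f' (Icc a b) := by
  obtain ⟨g, h1, h2, _⟩ := h
  exact ⟨g, h1, by simpa [uIcc_of_le hab] using h2.continuousOn⟩

lemma IsStringCoeff.isC1StringCoeff {a b : ℝ} {ρ σ q : ℝ → ℝ} (hab : a < b)
    (h : IsStringCoeff a b ρ σ q) : IsC1StringCoeff a b ρ σ q where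
  lt := hab
  density_pos x hx := by
    obtain ⟨c, hc, H⟩ := h.density_pos
    exact hc.trans_le (H x hx)
  tension_pos x hx := by
    obtain ⟨c, hc, H⟩ := h.tension_pos
    exact hc.trans_le (H x hx)
  density_deriv := h.memH2_density.exists_deriv hab.le
  tension_deriv := h.memH2_tension.exists_deriv hab.le
  integrable_potential := h.integrable_potential
  potential_nonneg := h.potential_nonneg

lemma HasDerivWithinAt.comp_neg_Icc {f : ℝ → ℝ} {f' a b x : ℝ}
    (h : HasDerivWithinAt f f' (Icc a b) (-x)) :
    HasDerivWithinAt (fun y => f (-y)) (-f') (Icc (-b) (-a)) x := by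
  have := h.comp x (hasDerivAt_neg x).hasDerivWithinAt (s := Icc (-b) (-a))
    (fun y hy => ⟨by linarith [hy.2], by linarith [hy.1]⟩)
  simpa [Function.comp_def] using this

lemma exists_deriv_comp_neg {f : ℝ → ℝ} {a b : ℝ}
    (h : ∃ f' : ℝ → ℝ, (∀ x ∈ Icc a b, HasDerivWithinAt f (f' x) (Icc a b) x) ∧
      ContinuousOn f' (Icc a b)) :
    ∃ f' : ℝ → ℝ, (∀ x ∈ Icc (-b) (-a),
      HasDerivWithinAt (fun y => f (-y)) (f' x) (Icc (-b) (-a)) x) ∧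
      ContinuousOn f' (Icc (-b) (-a)) := by
  obtain ⟨f', h1, h2⟩ := h
  have hm : ∀ x ∈ Icc (-b) (-a), -x ∈ Icc a b :=
    fun y hy => ⟨by linarith [hy.2], by linarith [hy.1]⟩
  exact ⟨fun x => -f' (-x), fun x hx => (h1 _ (hm x hx)).comp_neg_Icc,
    (h2.comp continuous_neg.continuousOn hm).neg⟩

/-! ### Prüfer angles: bounds, monotonicity and continuity in the spectral parameter -/

/-- `θ` is a Prüfer angle of the equation `-(σ y')' + q y = l ρ y` on `[a, b]`. -/
def IsPruferAngle (a b : ℝ) (ρ σ q : ℝ → ℝ) (l : ℝ) (θ : ℝ → ℝ) : Prop :=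
  HasACDeriv θ (fun x => (σ x)⁻¹ + (l * ρ x - q x - (σ x)⁻¹) * Real.sin (θ x) ^ 2) a b

/-- Factoring out `u - v` with the continuous function `sinc` makes the difference of two angular
equations a linear equation for the difference of the angles, to which variation of constants
applies. -/
lemma sin_sq_sub_sin_sq (u v : ℝ) :
    Real.sin u ^ 2 - Real.sin v ^ 2 = Real.sin (u + v) * Real.sinc (u - v) * (u - v) := by
  have h : Real.sinc (u - v) * (u - v) = Real.sin (u - v) := by
    rcases eq_or_ne (u - v) 0 with h | h
    · simp [h]
    · rw [Real.sinc_of_ne_zero h]; field_simp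
  rw [mul_assoc, h, Real.sin_sub, Real.sin_add]
  nlinarith [Real.sin_sq_add_cos_sq u, Real.sin_sq_add_cos_sq v]

lemma HasACDeriv.exists_primitive {f : ℝ → ℝ} {a b : ℝ} (hab : a ≤ b)
    (hf : IntegrableOn f (Ioo a b)) : ∃ F, HasACDeriv F f a b ∧ F a = 0 :=
  ⟨_, .of_integral hab hf 0, by simp⟩

/-- Solutions of the linear equation `d' = A d + B` with `0 ≤ B` stay positive. -/
lemma HasACDeriv.pos_of_linear {d A B : ℝ → ℝ} {a b : ℝ} (hab : a ≤ b)
    (hd : HasACDeriv d (fun x => A x * d x + B x) a b) (hA : IntegrableOn A (Ioo a b))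
    (hB : ∀ᵐ x ∂volume.restrict (Ioo a b), 0 ≤ B x) (ha : 0 < d a) : 0 < d b := by
  have hE := HasACDeriv.of_integral hab hA 0
  have h1 := (hd.exp_neg_mul hE).monotoneOn (by filter_upwards [hB] with x hx; positivity)
    (left_mem_Icc.2 hab) (right_mem_Icc.2 hab) hab
  simp only at h1
  have h2 : 0 < Real.exp (-(0 + ∫ t in a..a, A t)) * d a := by positivity
  exact pos_of_mul_pos_right (h2.trans_le h1) (Real.exp_pos _).le

namespace IsC1StringCoeff

variable {a b : ℝ} {ρ σ q : ℝ → ℝ}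

lemma continuousOn_density (h : IsC1StringCoeff a b ρ σ q) : ContinuousOn ρ (Icc a b) := by
  obtain ⟨ρ', h1, _⟩ := h.density_deriv
  exact fun x hx => (h1 x hx).continuousWithinAt

lemma continuousOn_tension (h : IsC1StringCoeff a b ρ σ q) : ContinuousOn σ (Icc a b) := by
  obtain ⟨σ', h1, _⟩ := h.tension_deriv
  exact fun x hx => (h1 x hx).continuousWithinAt

lemma continuousOn_inv_tension (h : IsC1StringCoeff a b ρ σ q) :
    ContinuousOn (fun x => (σ x)⁻¹) (Icc a b) :=
  h.continuousOn_tension.inv₀ fun x hx => (h.tension_pos x hx).ne'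

lemma comp_neg (h : IsC1StringCoeff a b ρ σ q) :
    IsC1StringCoeff (-b) (-a) (fun x => ρ (-x)) (fun x => σ (-x)) (fun x => q (-x)) where
  lt := neg_lt_neg h.lt
  density_pos x hx := h.density_pos _ ⟨by linarith [hx.2], by linarith [hx.1]⟩
  tension_pos x hx := h.tension_pos _ ⟨by linarith [hx.2], by linarith [hx.1]⟩
  density_deriv := exists_deriv_comp_neg h.density_deriv
  tension_deriv := exists_deriv_comp_neg h.tension_deriv
  integrable_potential := HasACDeriv.integrableOn_Ioo_neg h.integrable_potential
  potential_nonneg := HasACDeriv.ae_restrict_Ioo_neg h.potential_nonneg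

lemma integrableOn_coeff (h : IsC1StringCoeff a b ρ σ q) (l : ℝ) :
    IntegrableOn (fun x => l * ρ x - q x - (σ x)⁻¹) (Ioo a b) :=
  ((continuousOn_const.mul h.continuousOn_density).integrableOn_Ioo.sub
    h.integrable_potential).sub h.continuousOn_inv_tension.integrableOn_Ioo

lemma exists_angle (h : IsC1StringCoeff a b ρ σ q) (l α : ℝ) :
    ∃ θ, IsPruferAngle a b ρ σ q l θ ∧ θ a = α :=
  exists_hasACDeriv_angle h.lt.le h.continuousOn_inv_tension.integrableOn_Ioo
    (h.integrableOn_coeff l) α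

lemma integrableOn_slope (h : IsC1StringCoeff a b ρ σ q) (l : ℝ) {u v : ℝ → ℝ}
    (hu : ContinuousOn u (Icc a b)) (hv : ContinuousOn v (Icc a b)) :
    IntegrableOn (fun x => (l * ρ x - q x - (σ x)⁻¹) *
      (Real.sin (u x) * Real.sinc (v x))) (Ioo a b) :=
  (h.integrableOn_coeff l).mul_continuousOn_Icc
    ((Real.continuous_sin.comp_continuousOn hu).mul (Real.continuous_sinc.comp_continuousOn hv))

/-- Since `sin² θ = (sin θ sinc θ) θ`, the angle solves a linear equation with inhomogeneity `1/σ`.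
After multiplication by the integrating factor it grows at least at the rate of the minimum of `D /
σ`, which is positive by compactness. -/
lemma angle_pos (h : IsC1StringCoeff a b ρ σ q) {l : ℝ} {θ : ℝ → ℝ}
    (hθ : IsPruferAngle a b ρ σ q l θ) (ha : θ a = 0) : 0 < θ b := by
  have hc := HasACDeriv.continuousOn h.lt.le hθ
  have hA := h.integrableOn_slope l hc hc
  have hE := HasACDeriv.of_integral h.lt.le hA 0
  have hd : HasACDeriv θ (fun x => (l * ρ x - q x - (σ x)⁻¹) *
      (Real.sin (θ x) * Real.sinc (θ x)) * θ x + (σ x)⁻¹) a b := by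
    refine hθ.congr_right fun x _ => ?_
    have := sin_sq_sub_sin_sq (θ x) 0
    simp only [Real.sin_zero, sub_zero, add_zero] at this
    linear_combination (l * ρ x - q x - (σ x)⁻¹) * this
  have h1 := hd.exp_neg_mul hE
  set D := fun x => Real.exp (-(0 + ∫ t in a..x, (l * ρ t - q t - (σ t)⁻¹) *
      (Real.sin (θ t) * Real.sinc (θ t)))) with hD
  have hcont : ContinuousOn (fun x => D x * (σ x)⁻¹) (Icc a b) :=
    (Real.continuous_exp.comp_continuousOn (hE.continuousOn h.lt.le).neg).mul
      h.continuousOn_inv_tension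
  obtain ⟨z, hz, hmin⟩ := isCompact_Icc.exists_isMinOn (nonempty_Icc.2 h.lt.le) hcont
  have hpos : 0 < D z * (σ z)⁻¹ := mul_pos (Real.exp_pos _) (inv_pos.2 (h.tension_pos z hz))
  have hlin : HasACDeriv (fun x => D z * (σ z)⁻¹ * x) (fun _ => D z * (σ z)⁻¹) a b :=
    .of_hasDerivWithinAt h.lt (fun x _ => by
      simpa using ((hasDerivAt_id x).const_mul (D z * (σ z)⁻¹)).hasDerivWithinAt)
      continuousOn_const
  have h2 := (h1.sub hlin).monotoneOn (by
    filter_upwards [ae_restrict_mem measurableSet_Ioo] with x hx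
    have := isMinOn_iff.1 hmin x (Ioo_subset_Icc_self hx)
    simp only [hD] at this ⊢
    linarith) (left_mem_Icc.2 h.lt.le) (right_mem_Icc.2 h.lt.le) h.lt.le
  simp only [ha, mul_zero] at h2
  have h3 : 0 < D z * (σ z)⁻¹ * (b - a) := mul_pos hpos (sub_pos.2 h.lt)
  exact pos_of_mul_pos_right (a := D b) (by linarith) (Real.exp_pos _).le

/-- For `l = 0` the gap `π/2 - θ` solves a linear equation with inhomogeneity `q sin² θ`,
nonnegative because `q` is, so it stays positive. This is what later makes all the eigenvalues of
the joined problems positive. -/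
lemma angle_zero_lt (h : IsC1StringCoeff a b ρ σ q) {θ : ℝ → ℝ}
    (hθ : IsPruferAngle a b ρ σ q 0 θ) (ha : θ a = 0) : θ b < Real.pi / 2 := by
  have hπ : HasACDeriv (fun _ => Real.pi / 2) (fun _ => 0) a b :=
    .of_hasDerivWithinAt h.lt (fun x _ => hasDerivWithinAt_const _ _ _) continuousOn_const
  have hs := hπ.sub hθ
  have hc := hs.continuousOn h.lt.le
  have hd : HasACDeriv (fun x => Real.pi / 2 - θ x) (fun x =>
      -(σ x)⁻¹ * (Real.sin (Real.pi / 2 - θ x) * Real.sinc (Real.pi / 2 - θ x)) *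
        (Real.pi / 2 - θ x) + q x * Real.sin (θ x) ^ 2) a b := by
    refine hs.congr_right fun x _ => ?_
    have := sin_sq_sub_sin_sq (Real.pi / 2 - θ x) 0
    simp only [Real.sin_zero, sub_zero, add_zero] at this
    have h2 : Real.sin (Real.pi / 2 - θ x) ^ 2 = 1 - Real.sin (θ x) ^ 2 := by
      rw [Real.sin_pi_div_two_sub, Real.cos_sq']
    linear_combination -(σ x)⁻¹ * this + (σ x)⁻¹ * h2
  have := hd.pos_of_linear h.lt.le ?_ ?_ ?_
  · linarith
  · exact h.continuousOn_inv_tension.neg.integrableOn_Ioo.mul_continuousOn_Icc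
      ((Real.continuous_sin.comp_continuousOn hc).mul
        (Real.continuous_sinc.comp_continuousOn hc))
  · filter_upwards [h.potential_nonneg] with x hx
    positivity
  · rw [ha]; simp [Real.pi_pos]

lemma hasACDeriv_angle_sub {l m : ℝ} {θ ψ : ℝ → ℝ}
    (hθ : IsPruferAngle a b ρ σ q l θ) (hψ : IsPruferAngle a b ρ σ q m ψ) :
    HasACDeriv (fun x => ψ x - θ x) (fun x => (l * ρ x - q x - (σ x)⁻¹) *
      (Real.sin (ψ x + θ x) * Real.sinc (ψ x - θ x)) * (ψ x - θ x) +
      (m - l) * ρ x * Real.sin (ψ x) ^ 2) a b := by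
  refine (HasACDeriv.sub hψ hθ).congr_right fun x _ => ?_
  linear_combination (l * ρ x - q x - (σ x)⁻¹) * sin_sq_sub_sin_sq (ψ x) (θ x)

/-- Up to an integrating factor, `ψ - θ` increases from `0` at the rate `(m - l) ρ sin² ψ`. Were it
zero at `b`, it would vanish throughout, forcing `sin ψ = 0` on the whole interval; but where `sin ψ
= 0` the angle moves at speed `1/σ > 0`. -/
lemma angle_lt_angle (h : IsC1StringCoeff a b ρ σ q) {l m : ℝ} {θ ψ : ℝ → ℝ}
    (hθ : IsPruferAngle a b ρ σ q l θ) (hψ : IsPruferAngle a b ρ σ q m ψ)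
    (ha : θ a = ψ a) (hlm : l < m) : θ b < ψ b := by
  have hcθ := HasACDeriv.continuousOn h.lt.le hθ
  have hcψ := HasACDeriv.continuousOn h.lt.le hψ
  have hE := HasACDeriv.of_integral h.lt.le
    (h.integrableOn_slope l (hcψ.add hcθ) (hcψ.sub hcθ)) 0
  have hD := (hasACDeriv_angle_sub hθ hψ).exp_neg_mul hE
  simp only [Pi.add_apply, Pi.sub_apply] at hD
  have hm := hD.monotoneOn (by
    filter_upwards [ae_restrict_mem measurableSet_Ioo] with x hx
    have := h.density_pos x (Ioo_subset_Icc_self hx)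
    have := sub_pos.2 hlm
    positivity)
  have hD0 : ∀ x ∈ Icc a b, 0 ≤ ψ x - θ x := by
    intro x hx
    have := hm (left_mem_Icc.2 h.lt.le) hx hx.1
    simp only [ha, sub_self, mul_zero] at this
    exact nonneg_of_mul_nonneg_right this (Real.exp_pos _)
  refine lt_of_le_of_ne (by linarith [hD0 b (right_mem_Icc.2 h.lt.le)]) fun hb => ?_
  have hz : ∀ x ∈ Icc a b, ψ x - θ x = 0 := by
    intro x hx
    have := hm hx (right_mem_Icc.2 h.lt.le) hx.2
    simp only [hb, sub_self, mul_zero] at this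
    exact le_antisymm (nonpos_of_mul_nonpos_right this (Real.exp_pos _)) (hD0 x hx)
  have hsin : ∀ᵐ x ∂volume.restrict (Ioo a b), Real.sin (ψ x) = 0 := by
    filter_upwards [(hasACDeriv_angle_sub hθ hψ).2, ae_restrict_mem measurableSet_Ioo]
      with x hx hm
    have h0 : HasDerivAt (fun x => ψ x - θ x) 0 x := by
      refine (hasDerivAt_const x (0 : ℝ)).congr_of_eventuallyEq ?_
      filter_upwards [isOpen_Ioo.mem_nhds hm] with y hy using hz y (Ioo_subset_Icc_self hy)
    have e := hx.unique h0
    rw [hz x (Ioo_subset_Icc_self hm), mul_zero, zero_add] at e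
    have := h.density_pos x (Ioo_subset_Icc_self hm)
    have := sub_pos.2 hlm
    have h3 := (mul_eq_zero.1 e).resolve_left (by positivity)
    exact pow_eq_zero_iff (two_ne_zero) |>.1 h3
  have hsin' : EqOn (fun x => Real.sin (ψ x)) (fun _ => 0) (Ioo a b) :=
    Measure.eqOn_open_of_ae_eq hsin isOpen_Ioo
      ((Real.continuous_sin.comp_continuousOn hcψ).mono Ioo_subset_Icc_self) continuousOn_const
  have hfalse : ∀ᵐ x ∂volume.restrict (Ioo a b), False := by
    filter_upwards [hψ.2, ae_restrict_mem measurableSet_Ioo] with x hx hm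
    have h0 : HasDerivAt (fun x => Real.sin (ψ x)) 0 x := by
      refine (hasDerivAt_const x (0 : ℝ)).congr_of_eventuallyEq ?_
      filter_upwards [isOpen_Ioo.mem_nhds hm] with y hy using hsin' hy
    have e := hx.sin.unique h0
    have hs : Real.sin (ψ x) = 0 := hsin' hm
    have hp := h.tension_pos x (Ioo_subset_Icc_self hm)
    simp only [hs, ne_eq, OfNat.ofNat_ne_zero, not_false_eq_true, zero_pow, mul_zero, add_zero,
      mul_eq_zero, inv_eq_zero, hp.ne', or_false] at e
    have := Real.sin_sq_add_cos_sq (ψ x)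
    simp [hs, e] at this
  rw [eventually_false_iff_eq_bot, ae_eq_bot, Measure.restrict_eq_zero, Real.volume_Ioo,
    ENNReal.ofReal_eq_zero] at hfalse
  linarith [h.lt]

/-- Gronwall's estimate, with constants independent of the angles; it gives continuity in `l`. The
exponent of the integrating factor is at most `N = |l| I + J` in absolute value, and the factor is
paid for twice, inside the integral and when it is removed at `b`; hence the `2`. -/
lemma exists_angle_sub_le (h : IsC1StringCoeff a b ρ σ q) :
    ∃ I J : ℝ, 0 ≤ I ∧ 0 ≤ J ∧ ∀ l m : ℝ, ∀ θ ψ : ℝ → ℝ, IsPruferAngle a b ρ σ q l θ →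
      IsPruferAngle a b ρ σ q m ψ → θ a = ψ a → l ≤ m →
      ψ b - θ b ≤ Real.exp (2 * (|l| * I + J)) * ((m - l) * I) := by
  obtain ⟨I, hI, Ia⟩ := HasACDeriv.exists_primitive h.lt.le
    h.continuousOn_density.integrableOn_Ioo
  obtain ⟨J, hJ, Ja⟩ := HasACDeriv.exists_primitive (f := fun x => |q x| + (σ x)⁻¹) h.lt.le
    (h.integrable_potential.abs.add h.continuousOn_inv_tension.integrableOn_Ioo)
  have la := left_mem_Icc.2 h.lt.le
  have rb := right_mem_Icc.2 h.lt.le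
  have Imono := hI.monotoneOn (by
    filter_upwards [ae_restrict_mem measurableSet_Ioo] with x hx
    exact (h.density_pos x (Ioo_subset_Icc_self hx)).le)
  have Jmono := hJ.monotoneOn (by
    filter_upwards [ae_restrict_mem measurableSet_Ioo] with x hx
    have := h.tension_pos x (Ioo_subset_Icc_self hx)
    positivity)
  refine ⟨I b, J b, Ia ▸ Imono la rb h.lt.le, Ja ▸ Jmono la rb h.lt.le, ?_⟩
  intro l m θ ψ hθ hψ ha hlm
  have hcθ := HasACDeriv.continuousOn h.lt.le hθ
  have hcψ := HasACDeriv.continuousOn h.lt.le hψ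
  obtain ⟨E, hE, Ea⟩ := HasACDeriv.exists_primitive h.lt.le
    (h.integrableOn_slope l (hcψ.add hcθ) (hcψ.sub hcθ))
  have hD := (hasACDeriv_angle_sub hθ hψ).exp_neg_mul hE
  simp only [Pi.add_apply, Pi.sub_apply] at hE
  have hlI : HasACDeriv (fun x => |l| * I x + J x) (fun x => |l| * ρ x + (|q x| + (σ x)⁻¹))
      a b := by
    refine HasACDeriv.add ⟨hI.1.const_mul _, ?_⟩ hJ
    filter_upwards [hI.2] with x hx using hx.const_mul _
  have hEb : ∀ x ∈ Icc a b, |E x| ≤ |l| * I b + J b := by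
    intro x hx
    have h1 := hE.abs_sub_le hlI (by
      filter_upwards [ae_restrict_mem measurableSet_Ioo] with t ht
      have h1 := h.density_pos t (Ioo_subset_Icc_self ht)
      have h2 := h.tension_pos t (Ioo_subset_Icc_self ht)
      rw [abs_mul, abs_mul]
      have h3 : |Real.sin (ψ t + θ t)| * |Real.sinc (ψ t - θ t)| ≤ 1 :=
        mul_le_one₀ (Real.abs_sin_le_one _) (abs_nonneg _) (Real.abs_sinc_le_one _)
      have h4 : |l * ρ t - q t - (σ t)⁻¹| ≤ |l| * ρ t + (|q t| + (σ t)⁻¹) := by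
        refine (abs_sub _ _).trans ?_
        refine (add_le_add (abs_sub _ _) le_rfl).trans ?_
        rw [abs_mul, abs_of_pos h1, abs_of_pos (inv_pos.2 h2), add_assoc]
      nlinarith [abs_nonneg (l * ρ t - q t - (σ t)⁻¹)]) hx
    have h2 := Imono hx rb hx.2
    have h3 := Jmono hx rb hx.2
    simp only [Ea, Ia, Ja, mul_zero, add_zero, sub_zero] at h1
    have := mul_le_mul_of_nonneg_left h2 (abs_nonneg l)
    linarith
  set N := |l| * I b + J b with hN
  have hG : HasACDeriv (fun x => Real.exp N * (m - l) * I x)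
      (fun x => Real.exp N * (m - l) * ρ x) a b :=
    ⟨hI.1.const_mul _, by filter_upwards [hI.2] with x hx using hx.const_mul _⟩
  have key := hD.abs_sub_le hG (by
    filter_upwards [ae_restrict_mem measurableSet_Ioo] with x hx
    have h1 := h.density_pos x (Ioo_subset_Icc_self hx)
    have h2 : Real.exp (-E x) ≤ Real.exp N :=
      Real.exp_le_exp.2 (by linarith [(abs_le.1 (hEb x (Ioo_subset_Icc_self hx))).1])
    have h3 := sub_nonneg.2 hlm
    rw [abs_of_nonneg (by positivity)]
    calc _ ≤ Real.exp N * ((m - l) * ρ x * 1) := by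
          gcongr
          exact Real.sin_sq_le_one _
      _ = _ := by ring) rb
  simp only [Ea, ha, Ia, sub_self, mul_zero, sub_zero] at key
  have e : ψ b - θ b = Real.exp (E b) * (Real.exp (-E b) * (ψ b - θ b)) := by
    rw [← mul_assoc, ← Real.exp_add]; simp
  rw [e]
  calc _ ≤ Real.exp (E b) * (Real.exp N * (m - l) * I b) :=
        mul_le_mul_of_nonneg_left ((le_abs_self _).trans key) (Real.exp_pos _).le
    _ ≤ Real.exp N * (Real.exp N * (m - l) * I b) := by
        have h1 : Real.exp (E b) ≤ Real.exp N :=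
          Real.exp_le_exp.2 ((le_abs_self _).trans (hEb b rb))
        have h2 : 0 ≤ I b := Ia ▸ Imono la rb h.lt.le
        have h3 := sub_nonneg.2 hlm
        gcongr
    _ = Real.exp (2 * N) * ((m - l) * I b) := by
        rw [two_mul, Real.exp_add N N]; simp only [mul_assoc]

lemma continuous_angle (h : IsC1StringCoeff a b ρ σ q) {θ : ℝ → ℝ → ℝ}
    (hθ : ∀ l, IsPruferAngle a b ρ σ q l (θ l)) (ha : ∀ l, θ l a = 0) :
    Continuous fun l => θ l b := by
  obtain ⟨I, J, hI, hJ, H⟩ := h.exists_angle_sub_le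
  have hm : StrictMono fun l => θ l b := fun l m hlm =>
    h.angle_lt_angle (hθ l) (hθ m) (by rw [ha, ha]) hlm
  -- The larger quantity `|l| + |m|` replaces `|l|` to make the bound symmetric in `l` and `m`.
  have key (l m : ℝ) : dist (θ m b) (θ l b) ≤
      Real.exp (2 * ((|l| + |m|) * I + J)) * (|m - l| * I) := by
    wlog hlm : l ≤ m generalizing l m
    · have := this m l (by linarith)
      rwa [dist_comm, add_comm |l|, abs_sub_comm]
    rw [Real.dist_eq, abs_of_nonneg (sub_nonneg.2 (hm.monotone hlm)),
      abs_of_nonneg (sub_nonneg.2 hlm)]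
    refine (H l m _ _ (hθ l) (hθ m) (by rw [ha, ha]) hlm).trans ?_
    have := sub_nonneg.2 hlm
    gcongr
    linarith [abs_nonneg m]
  rw [continuous_iff_continuousAt]
  intro l
  rw [ContinuousAt, tendsto_iff_dist_tendsto_zero]
  refine squeeze_zero (fun _ => dist_nonneg) (fun m => key l m) ?_
  have : Continuous fun m => Real.exp (2 * ((|l| + |m|) * I + J)) * (|m - l| * I) := by fun_prop
  simpa using this.tendsto l

end IsC1StringCoeff

/-! ### Solutions of the string equation and their polar form -/

/-- The first order system `y' = p / σ`, `p' = (q - l ρ) y` equivalent to the equation of the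
string. -/
def IsStringSystem (a b : ℝ) (ρ σ q : ℝ → ℝ) (l : ℝ) (y p : ℝ → ℝ) : Prop :=
  HasACDeriv y (fun x => (σ x)⁻¹ * p x) a b ∧ HasACDeriv p (fun x => (q x - l * ρ x) * y x) a b

namespace IsStringSystem

variable {a b : ℝ} {ρ σ q : ℝ → ℝ} {l : ℝ} {y p z w : ℝ → ℝ}

lemma wronskian_eq (h₁ : IsStringSystem a b ρ σ q l y p) (h₂ : IsStringSystem a b ρ σ q l z w)
    {x : ℝ} (hx : x ∈ Icc a b) : y x * w x - p x * z x = y a * w a - p a * z a :=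
  HasACDeriv.eq_left ((h₁.1.mul h₂.2).sub (h₁.2.mul h₂.1))
    (Eventually.of_forall fun x => by ring) hx

lemma hasDerivWithinAt (h : IsStringSystem a b ρ σ q l y p) (hc : IsC1StringCoeff a b ρ σ q)
    {x : ℝ} (hx : x ∈ Icc a b) : HasDerivWithinAt y ((σ x)⁻¹ * p x) (Icc a b) x :=
  h.1.hasDerivWithinAt hc.lt
    (hc.continuousOn_inv_tension.mul (h.2.continuousOn hc.lt.le)) hx

lemma indicator_mem (h : IsStringSystem a b ρ σ q l y p) (hc : IsC1StringCoeff a b ρ σ q) :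
    (Icc a b).indicator y ∈ stringSolutions a b ρ σ q l := by
  have e : ∀ x ∈ Icc a b, p x = σ x * ((σ x)⁻¹ * p x) := fun x hx => by
    rw [mul_inv_cancel_left₀ (hc.tension_pos x hx).ne']
  have h2 := h.2.congr_left hc.lt.le e
  refine ⟨fun x hx => indicator_of_notMem hx y, fun x => (σ x)⁻¹ * p x, fun x hx => ?_, h2.1, ?_⟩
  · exact (h.hasDerivWithinAt hc hx).congr (fun z hz => indicator_of_mem hz y)
      (indicator_of_mem hx y)
  · refine (h2.congr_right fun x hx => ?_).2
    rw [indicator_of_mem (Ioo_subset_Icc_self hx)]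
    ring

lemma tension_mul_derivWithin_indicator (h : IsStringSystem a b ρ σ q l y p)
    (hc : IsC1StringCoeff a b ρ σ q) {x : ℝ} (hx : x ∈ Icc a b) :
    σ x * derivWithin ((Icc a b).indicator y) (Icc a b) x = p x := by
  have h1 := (h.hasDerivWithinAt hc hx).congr (fun z hz => indicator_of_mem hz y)
      (indicator_of_mem hx y)
  rw [h1.derivWithin (uniqueDiffOn_Icc hc.lt x hx),
    mul_inv_cancel_left₀ (hc.tension_pos x hx).ne']

end IsStringSystem

namespace IsC1StringCoeff

variable {a b : ℝ} {ρ σ q : ℝ → ℝ} {l : ℝ}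

lemma exists_isStringSystem_of_mem (h : IsC1StringCoeff a b ρ σ q) {u : ℝ → ℝ}
    (hu : u ∈ stringSolutions a b ρ σ q l) : ∃ p, IsStringSystem a b ρ σ q l u p := by
  obtain ⟨_, u', hd, hac, hae⟩ := hu
  have hp : HasACDeriv (fun x => σ x * u' x) (fun x => q x * u x - l * (ρ x * u x)) a b :=
    ⟨hac, hae⟩
  have e : ∀ x ∈ Icc a b, u' x = (σ x)⁻¹ * (σ x * u' x) := fun x hx => by
    rw [inv_mul_cancel_left₀ (h.tension_pos x hx).ne']
  -- Continuity of `u'`, inherited from `σ u'` because `σ` is continuous and positive, makes `u`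
  -- itself absolutely continuous.
  have hc : ContinuousOn u' (Icc a b) :=
    (h.continuousOn_inv_tension.mul (hp.continuousOn h.lt.le)).congr e
  exact ⟨fun x => σ x * u' x, (HasACDeriv.of_hasDerivWithinAt h.lt hd hc).congr_right
    fun x hx => e x (Ioo_subset_Icc_self hx), hp.congr_right fun x _ => by ring⟩

/-- The polar representation of a solution with a given Prüfer angle. -/
lemma exists_isStringSystem_of_angle (h : IsC1StringCoeff a b ρ σ q) {θ : ℝ → ℝ}
    (hθ : IsPruferAngle a b ρ σ q l θ) :
    ∃ r : ℝ → ℝ, (∀ x, 0 < r x) ∧ IsStringSystem a b ρ σ q l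
      (fun x => r x * Real.sin (θ x)) (fun x => r x * Real.cos (θ x)) := by
  have hc := HasACDeriv.continuousOn h.lt.le hθ
  have hint := (h.integrableOn_coeff l).neg.mul_continuousOn_Icc
    ((Real.continuous_sin.comp_continuousOn hc).mul (Real.continuous_cos.comp_continuousOn hc))
  obtain ⟨R, hR, _⟩ := HasACDeriv.exists_primitive h.lt.le hint
  have hr := hR.comp Real.hasDerivAt_exp Real.continuous_exp
  have hs := HasACDeriv.comp hθ Real.hasDerivAt_sin Real.continuous_cos
  have hco := HasACDeriv.comp hθ Real.hasDerivAt_cos Real.continuous_sin.neg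
  refine ⟨fun x => Real.exp (R x), fun x => Real.exp_pos _,
    (hr.mul hs).congr_right fun x _ => ?_, (hr.mul hco).congr_right fun x _ => ?_⟩
  · simp only [Pi.neg_apply, Pi.mul_apply, Function.comp]
    ring
  · simp only [Pi.neg_apply, Pi.mul_apply, Function.comp]
    linear_combination (-Real.exp (R x) * Real.sin (θ x) * (l * ρ x - q x - (σ x)⁻¹)) *
      Real.sin_sq_add_cos_sq (θ x)

/-- Constancy of Wronskians takes the place of a uniqueness theorem. A third solution `v`, with
angle `π/2` at `a`, is brought in; three vectors of the plane satisfy `z W(y,v) - y W(z,v) + v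
W(z,y) = 0`, and here `W(z,y) = 0` while the other two Wronskians are constants that can be read off
at `a`. -/
lemma exists_eq_mul (h : IsC1StringCoeff a b ρ σ q) {y p z w : ℝ → ℝ}
    (hy : IsStringSystem a b ρ σ q l y p) (hz : IsStringSystem a b ρ σ q l z w)
    (hya : y a = 0) (hpa : p a ≠ 0) (hza : z a = 0) :
    ∃ c : ℝ, ∀ x ∈ Icc a b, z x = c * y x := by
  obtain ⟨θ, hθ, hθa⟩ := h.exists_angle l (Real.pi / 2)
  obtain ⟨r, hr, hv⟩ := h.exists_isStringSystem_of_angle hθ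
  set v := fun x => r x * Real.sin (θ x) with hvdef
  set t := fun x => r x * Real.cos (θ x) with htdef
  have hva : v a = r a := by simp [hvdef, hθa]
  have hta : t a = 0 := by simp [htdef, hθa]
  refine ⟨w a / p a, fun x hx => ?_⟩
  have h1 := hz.wronskian_eq hy hx
  have h2 := hz.wronskian_eq hv hx
  have h3 := hy.wronskian_eq hv hx
  rw [hza, hya] at h1
  rw [hza, hva, hta] at h2
  rw [hya, hva, hta] at h3
  have e : p a * r a * z x = w a * r a * y x := by
    linear_combination z x * h3 - y x * h2 + v x * h1
  have hr' := (hr a).ne'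
  field_simp
  have : r a * (p a * z x) = r a * (w a * y x) := by linear_combination e
  have := mul_left_cancel₀ hr' this
  linear_combination this

/-- The solution of the string equation vanishing at the left end point, described by its Prüfer
angle at the right end point. -/
lemma exists_solution (h : IsC1StringCoeff a b ρ σ q) {θ : ℝ → ℝ}
    (hθ : IsPruferAngle a b ρ σ q l θ) (ha : θ a = 0) :
    ∃ φ ∈ stringSolutions a b ρ σ q l, ∃ r > 0, φ a = 0 ∧ φ b = r * Real.sin (θ b) ∧
      σ b * derivWithin φ (Icc a b) b = r * Real.cos (θ b) ∧
      ∀ u ∈ stringSolutions a b ρ σ q l, u a = 0 → ∃ c : ℝ, u = c • φ := by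
  obtain ⟨r, hr, hs⟩ := h.exists_isStringSystem_of_angle hθ
  have la := left_mem_Icc.2 h.lt.le
  have rb := right_mem_Icc.2 h.lt.le
  refine ⟨_, hs.indicator_mem h, r b, hr b, ?_, indicator_of_mem rb _,
    hs.tension_mul_derivWithin_indicator h rb, fun u hu hua => ?_⟩
  · rw [indicator_of_mem la]; simp [ha]
  · obtain ⟨p, hp⟩ := h.exists_isStringSystem_of_mem hu
    obtain ⟨c, hc⟩ := h.exists_eq_mul hs hp (by simp [ha]) (by simp [ha, (hr a).ne']) hua
    refine ⟨c, funext fun x => ?_⟩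
    by_cases hx : x ∈ Icc a b
    · simp [indicator_of_mem hx, hc x hx]
    · simp only [Pi.smul_apply, indicator_of_notMem hx, smul_zero]
      exact hu.1 x hx

end IsC1StringCoeff

/-- Reflection of solutions. -/
lemma comp_neg_mem_stringSolutions {a b : ℝ} {ρ σ q : ℝ → ℝ} {l : ℝ} {u : ℝ → ℝ} (hab : a ≤ b)
    (hu : u ∈ stringSolutions a b ρ σ q l) :
    (fun x => u (-x)) ∈ stringSolutions (-b) (-a) (fun x => ρ (-x)) (fun x => σ (-x))
      (fun x => q (-x)) l := by
  obtain ⟨h0, u', hd, hac, hae⟩ := hu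
  have hm : ∀ x, x ∈ Icc (-b) (-a) ↔ -x ∈ Icc a b := fun y =>
    ⟨fun hy => ⟨by linarith [hy.2], by linarith [hy.1]⟩,
      fun hy => ⟨by linarith [hy.2], by linarith [hy.1]⟩⟩
  have hp : HasACDeriv (fun x => σ x * u' x) (fun x => q x * u x - l * (ρ x * u x)) a b :=
    ⟨hac, hae⟩
  have h2 : HasACDeriv (fun x => σ (-x) * -u' (-x))
      (fun x => q (-x) * u (-x) - l * (ρ (-x) * u (-x))) (-b) (-a) := by
    refine (((hp.comp_neg hab).neg).congr_left (neg_le_neg hab) fun x _ => ?_).congr_right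
      fun x _ => ?_ <;> ring
  exact ⟨fun x hx => h0 _ (by rwa [← hm]), fun x => -u' (-x),
    fun x hx => (hd _ ((hm x).1 hx)).comp_neg_Icc, h2⟩

/-- The reflection `x ↦ -x` exchanges the end points and reverses the sign of the derivative, whence
the minus sign at the cosine. -/
lemma IsC1StringCoeff.exists_solution_right {a b : ℝ} {ρ σ q : ℝ → ℝ} {l : ℝ}
    (h : IsC1StringCoeff a b ρ σ q) {θ : ℝ → ℝ}
    (hθ : IsPruferAngle (-b) (-a) (fun x => ρ (-x)) (fun x => σ (-x)) (fun x => q (-x)) l θ)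
    (hb : θ (-b) = 0) :
    ∃ φ ∈ stringSolutions a b ρ σ q l, ∃ r > 0, φ b = 0 ∧ φ a = r * Real.sin (θ (-a)) ∧
      σ a * derivWithin φ (Icc a b) a = -(r * Real.cos (θ (-a))) ∧
      ∀ u ∈ stringSolutions a b ρ σ q l, u b = 0 → ∃ c : ℝ, u = c • φ := by
  obtain ⟨φ, hφ, r, hr, h1, h2, h3, h4⟩ := h.comp_neg.exists_solution hθ hb
  have hφ' := comp_neg_mem_stringSolutions (neg_le_neg h.lt.le) hφ
  simp only [neg_neg] at hφ'
  have hd : derivWithin (fun x => φ (-x)) (Icc a b) a =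
      -derivWithin φ (Icc (-b) (-a)) (-a) := by
    have hm : -a ∈ Icc (-b) (-a) := right_mem_Icc.2 (neg_le_neg h.lt.le)
    have := (stringSolutions_differentiableWithinAt hφ hm).hasDerivWithinAt.comp_neg_Icc
    simp only [neg_neg] at this
    exact this.derivWithin (uniqueDiffOn_Icc h.lt a (left_mem_Icc.2 h.lt.le))
  refine ⟨fun x => φ (-x), hφ', r, hr, h1, h2, ?_, fun u hu hub => ?_⟩
  · rw [hd]
    simp only [neg_neg] at h3
    linarith
  · obtain ⟨c, hc⟩ := h4 _ (comp_neg_mem_stringSolutions h.lt.le hu) (by simpa using hub)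
    refine ⟨c, funext fun x => ?_⟩
    simpa using congrFun hc (-x)

/-! ### Large parameter behaviour of the Prüfer angle -/

lemma HasACDeriv.inv {F f : ℝ → ℝ} {a b : ℝ} (hab : a ≤ b) (hF : HasACDeriv F f a b)
    (hpos : ∀ x ∈ Icc a b, 0 < F x) :
    HasACDeriv (fun x => (F x)⁻¹) (fun x => -f x / F x ^ 2) a b := by
  refine ⟨?_, ?_⟩
  · obtain ⟨z, hz, hmin⟩ := isCompact_Icc.exists_isMinOn (nonempty_Icc.2 hab)
      (hF.continuousOn hab)
    have hLip : LipschitzOnWith (Real.toNNReal ((F z ^ 2)⁻¹)) (fun y : ℝ => y⁻¹) (Ici (F z)) := by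
      refine LipschitzOnWith.of_dist_le_mul fun u hu v hv => ?_
      have hz0 := hpos z hz
      have hu0 : 0 < u := hz0.trans_le hu
      have hv0 : 0 < v := hz0.trans_le hv
      rw [Real.coe_toNNReal _ (by positivity), Real.dist_eq, Real.dist_eq,
        inv_sub_inv hu0.ne' hv0.ne', abs_div, abs_of_pos (mul_pos hu0 hv0), abs_sub_comm v u,
        div_eq_inv_mul]
      refine mul_le_mul_of_nonneg_right ?_ (abs_nonneg _)
      refine inv_anti₀ (by positivity) ?_
      rw [sq]
      exact mul_le_mul hu hv hz0.le hu0.le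
    exact hLip.comp_absolutelyContinuousOnInterval hF.1 fun x hx =>
      isMinOn_iff.1 hmin x (by rwa [uIcc_of_le hab] at hx)
  · filter_upwards [hF.2, ae_restrict_mem measurableSet_Ioo] with x hx hm
    exact hx.inv (hpos x (Ioo_subset_Icc_self hm)).ne'

/-- The derivative of the modified Prüfer angle `θ + arctan (N / D)`. -/
lemma modified_angle_deriv_eq {s c w w' t : ℝ} (hsc : s ^ 2 + c ^ 2 = 1) (hw : 0 < w) :
    t + (1 + ((w - 1) * (s * c) * (c ^ 2 + w * s ^ 2)⁻¹) ^ 2)⁻¹ *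
      ((w' * (s * c) + (w - 1) * (c * t * c + s * (-s * t))) * (c ^ 2 + w * s ^ 2)⁻¹ +
        (w - 1) * (s * c) * (-(2 * c * (-s * t) + (w' * s ^ 2 + w * (2 * s * (c * t)))) /
          (c ^ 2 + w * s ^ 2) ^ 2)) =
      (w' * (s * c) + w * t) / (c ^ 2 + w ^ 2 * s ^ 2) := by
  set N := (w - 1) * (s * c) with hN
  set D := c ^ 2 + w * s ^ 2 with hD
  set Q := c ^ 2 + w ^ 2 * s ^ 2 with hQ
  -- Lagrange's identity: `D` and `N` are the inner and the cross product of `(c, s)` and `(c, w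
  -- s)`, and the first vector has length one.
  have hsum : D ^ 2 + N ^ 2 = Q := by
    rw [hD, hN, hQ]
    linear_combination (c ^ 2 + w ^ 2 * s ^ 2) * hsc
  have hDpos : 0 < D := by
    rcases eq_or_ne s 0 with h | h
    · have : 0 < c ^ 2 := by rw [← zero_add (c ^ 2)]; nlinarith
      rw [hD, h]; linarith
    · positivity
  have hQpos : 0 < Q := by rw [← hsum]; positivity
  have h1 : (1 + (N * D⁻¹) ^ 2)⁻¹ = D ^ 2 / Q := by
    rw [← hsum]
    have : D ^ 2 + N ^ 2 ≠ 0 := by positivity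
    have : 1 + (N * D⁻¹) ^ 2 ≠ 0 := by positivity
    field_simp
  set N' := w' * (s * c) + (w - 1) * (c * t * c + s * (-s * t)) with hN'
  set D' := 2 * c * (-s * t) + (w' * s ^ 2 + w * (2 * s * (c * t))) with hD'
  have h2 : N' * D - N * D' = w' * (s * c) + (w - 1) * t * (c ^ 2 - w * s ^ 2) := by
    rw [hN', hD, hN, hD']
    linear_combination (w' * s * c + (w - 1) * t * (c ^ 2 - w * s ^ 2)) * hsc
  have h3 : t * Q + (N' * D - N * D') = w' * (s * c) + w * t := by
    rw [h2, hQ]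
    linear_combination (w * t) * hsc
  rw [h1, ← h3]
  field_simp
  ring

/-- The bound on the derivative of the modified Prüfer angle. -/
lemma modified_angle_deriv_bound {s c k S S' σ ρ q : ℝ} (hsc : s ^ 2 + c ^ 2 = 1) (hk : 1 ≤ k)
    (hS : 0 < S) (hσ : 0 < σ) (hq : 0 ≤ q) (hSS : S ^ 2 = ρ * σ) :
    |(k * S' * (s * c) + k * S * (σ⁻¹ + (k ^ 2 * ρ - q - σ⁻¹) * s ^ 2)) /
      (c ^ 2 + (k * S) ^ 2 * s ^ 2) - k * (S * σ⁻¹)| ≤ |S'| * S⁻¹ + q * S⁻¹ := by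
  have hk0 : 0 < k := by linarith
  have hQ : 0 < c ^ 2 + (k * S) ^ 2 * s ^ 2 := by
    rcases eq_or_ne s 0 with h | h
    · rw [h] at hsc ⊢
      have : c ^ 2 = 1 := by linarith
      rw [this]; norm_num
    · positivity
  have hρ : ρ = S ^ 2 / σ := by rw [hSS]; field_simp
  -- Because `S ^ 2 = ρ σ`, the `1/σ` and `k² ρ` terms combine exactly to `k S / σ` times the
  -- denominator and cancel; the remainder is bounded uniformly in `k ≥ 1`.
  have e : (k * S' * (s * c) + k * S * (σ⁻¹ + (k ^ 2 * ρ - q - σ⁻¹) * s ^ 2)) /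
      (c ^ 2 + (k * S) ^ 2 * s ^ 2) - k * (S * σ⁻¹) =
      (k * S' * (s * c) - k * S * q * s ^ 2) / (c ^ 2 + (k * S) ^ 2 * s ^ 2) := by
    rw [eq_div_iff hQ.ne', sub_mul, div_mul_cancel₀ _ hQ.ne', hρ]
    field_simp
    linear_combination (-S) * hsc
  rw [e, abs_div, abs_of_pos hQ, div_le_iff₀ hQ]
  have h1 : |k * S' * (s * c) - k * S * q * s ^ 2| ≤ k * |S'| * |s * c| + k * S * q * s ^ 2 := by
    refine (abs_sub _ _).trans ?_
    rw [abs_mul, abs_mul, abs_of_pos hk0, abs_of_nonneg (by positivity : 0 ≤ k * S * q * s ^ 2)]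
  have h2 : k * S * |s * c| ≤ c ^ 2 + (k * S) ^ 2 * s ^ 2 := by
    rw [abs_mul]
    have h := sq_nonneg (|c| - k * S * |s|)
    have := sq_abs s
    have := sq_abs c
    have : 0 ≤ |s| * |c| * (k * S) := by positivity
    nlinarith
  have h3 : k * S * s ^ 2 ≤ S⁻¹ * (c ^ 2 + (k * S) ^ 2 * s ^ 2) := by
    have h4 : S⁻¹ * (c ^ 2 + (k * S) ^ 2 * s ^ 2) = S⁻¹ * c ^ 2 + k * (k * S * s ^ 2) := by
      field_simp
    rw [h4]
    have : 0 ≤ S⁻¹ * c ^ 2 := by positivity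
    have : 0 ≤ k * S * s ^ 2 := by positivity
    nlinarith
  have h5 : k * |S'| * |s * c| ≤ |S'| * S⁻¹ * (c ^ 2 + (k * S) ^ 2 * s ^ 2) := by
    have : k * |S'| * |s * c| = |S'| * S⁻¹ * (k * S * |s * c|) := by field_simp
    rw [this]
    gcongr
  have h6 : k * S * q * s ^ 2 ≤ q * S⁻¹ * (c ^ 2 + (k * S) ^ 2 * s ^ 2) := by
    have := mul_le_mul_of_nonneg_left h3 hq
    linarith
  linarith

namespace IsC1StringCoeff

variable {a b : ℝ} {ρ σ q : ℝ → ℝ}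

lemma exists_sqrt_mul_deriv (h : IsC1StringCoeff a b ρ σ q) :
    ∃ S' : ℝ → ℝ, HasACDeriv (fun x => √(ρ x * σ x)) S' a b ∧ ContinuousOn S' (Icc a b) := by
  obtain ⟨ρ', h1, h2⟩ := h.density_deriv
  obtain ⟨σ', h3, h4⟩ := h.tension_deriv
  have hpos : ∀ x ∈ Icc a b, 0 < ρ x * σ x := fun x hx =>
    mul_pos (h.density_pos x hx) (h.tension_pos x hx)
  have hc : ContinuousOn (fun x => (ρ' x * σ x + ρ x * σ' x) / (2 * √(ρ x * σ x))) (Icc a b) := by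
    refine ((h2.mul h.continuousOn_tension).add (h.continuousOn_density.mul h4)).div
      (continuousOn_const.mul (h.continuousOn_density.mul h.continuousOn_tension).sqrt) ?_
    intro x hx
    have := Real.sqrt_pos.2 (hpos x hx)
    positivity
  exact ⟨_, .of_hasDerivWithinAt h.lt
    (fun x hx => ((h1 x hx).mul (h3 x hx)).sqrt (hpos x hx).ne') hc, hc⟩

lemma opticalLength_pos (h : IsC1StringCoeff a b ρ σ q) : 0 < opticalLength a b ρ σ := by
  have hc : ContinuousOn (fun x => √(ρ x / σ x)) (Icc a b) :=
    (h.continuousOn_density.div h.continuousOn_tension fun x hx => (h.tension_pos x hx).ne').sqrt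
  refine intervalIntegral.intervalIntegral_pos_of_pos_on ?_ (fun x hx => ?_) h.lt
  · exact ContinuousOn.intervalIntegrable (by rwa [uIcc_of_le h.lt.le])
  · have hx' := Ioo_subset_Icc_self hx
    exact Real.sqrt_pos.2 (div_pos (h.density_pos x hx') (h.tension_pos x hx'))

/-- The Prüfer angle at the right end point is `√l` times the optical length, up to a bounded
error. -/
theorem exists_abs_angle_sub_le (h : IsC1StringCoeff a b ρ σ q) :
    ∃ C : ℝ, ∀ l ≥ 1, ∀ θ : ℝ → ℝ, IsPruferAngle a b ρ σ q l θ → θ a = 0 →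
      |θ b - √l * opticalLength a b ρ σ| ≤ C := by
  obtain ⟨S', hS, hS'⟩ := h.exists_sqrt_mul_deriv
  have hSpos : ∀ x ∈ Icc a b, 0 < √(ρ x * σ x) := fun x hx =>
    Real.sqrt_pos.2 (mul_pos (h.density_pos x hx) (h.tension_pos x hx))
  have hSinv : ContinuousOn (fun x => (√(ρ x * σ x))⁻¹) (Icc a b) :=
    (hS.continuousOn h.lt.le).inv₀ fun x hx => (hSpos x hx).ne'
  obtain ⟨G, hG, Ga⟩ := HasACDeriv.exists_primitive h.lt.le
    (f := fun x => |S' x| * (√(ρ x * σ x))⁻¹ + q x * (√(ρ x * σ x))⁻¹)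
    ((hS'.abs.mul hSinv).integrableOn_Ioo.add
      (h.integrable_potential.mul_continuousOn_Icc hSinv))
  obtain ⟨Γ, hΓ, Γa⟩ := HasACDeriv.exists_primitive h.lt.le
    (f := fun x => √(ρ x * σ x) * (σ x)⁻¹)
    ((hS.continuousOn h.lt.le).mul h.continuousOn_inv_tension).integrableOn_Ioo
  have hΓb : Γ b = opticalLength a b ρ σ := by
    have h1 := hΓ.integral_eq_sub h.lt.le
    rw [Γa, sub_zero] at h1
    rw [← h1, opticalLength]
    refine intervalIntegral.integral_congr fun x hx => ?_
    rw [uIcc_of_le h.lt.le] at hx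
    have h2 := h.density_pos x hx
    have h3 := h.tension_pos x hx
    rw [Real.sqrt_mul h2.le, Real.sqrt_div h2.le, mul_assoc]
    congr 1
    nth_rewrite 2 [← Real.mul_self_sqrt h3.le]
    have := Real.sqrt_pos.2 h3
    field_simp
  -- `G b` bounds the deviation of the modified angle, `π/2` its distance from `θ`.
  refine ⟨G b + Real.pi / 2, fun l hl θ hθ ha => ?_⟩
  set k := √l with hk
  have hk1 : 1 ≤ k := Real.one_le_sqrt.2 hl
  have hkl : k ^ 2 = l := Real.sq_sqrt (by linarith)
  have hw : HasACDeriv (fun x => k * √(ρ x * σ x)) (fun x => k * S' x) a b :=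
    ⟨hS.1.const_mul k, by filter_upwards [hS.2] with x hx using hx.const_mul k⟩
  have hsin := HasACDeriv.comp hθ Real.hasDerivAt_sin Real.continuous_cos
  have hcos := HasACDeriv.comp hθ Real.hasDerivAt_cos Real.continuous_sin.neg
  have hsc := hsin.mul hcos
  have hsq (u : ℝ) : HasDerivAt (fun y : ℝ => y ^ 2) (2 * u) u := by
    simpa using hasDerivAt_pow 2 u
  have hsin2 := hsin.comp (φ := fun y => y ^ 2) (φ' := fun u => 2 * u) hsq (by fun_prop)
  have hcos2 := hcos.comp (φ := fun y => y ^ 2) (φ' := fun u => 2 * u) hsq (by fun_prop)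
  have hone : HasACDeriv (fun _ => 1) (fun _ => 0) a b :=
    .of_hasDerivWithinAt h.lt (fun x _ => hasDerivWithinAt_const _ _ _) continuousOn_const
  have hD := hcos2.add (hw.mul hsin2)
  have hDpos : ∀ x ∈ Icc a b,
      0 < Real.cos (θ x) ^ 2 + k * √(ρ x * σ x) * Real.sin (θ x) ^ 2 := by
    intro x hx
    have h1 := hSpos x hx
    rcases eq_or_ne (Real.sin (θ x)) 0 with h0 | h0
    · rw [Real.cos_sq', h0]; norm_num
    · positivity
  -- With `w = √l √(ρ σ)`, the modified angle is the angle of `(cos θ, w sin θ)`. It exceeds `θ` by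
  -- the arctangent of `N / D`; as `D > 0`, no branch has to be chosen. It vanishes at `a` together
  -- with `θ`.
  have hX := ((hw.sub hone).mul hsc).mul (hD.inv h.lt.le hDpos)
  have hΘ := HasACDeriv.add hθ (hX.comp (φ := Real.arctan) (φ' := fun u => (1 + u ^ 2)⁻¹)
    (fun u => by simpa using Real.hasDerivAt_arctan u)
    (Continuous.inv₀ (by fun_prop) fun u => by positivity))
  have hkΓ : HasACDeriv (fun x => k * Γ x) (fun x => k * (√(ρ x * σ x) * (σ x)⁻¹)) a b :=
    ⟨hΓ.1.const_mul k, by filter_upwards [hΓ.2] with x hx using hx.const_mul k⟩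
  have key := (hΘ.sub hkΓ).abs_sub_le hG (by
    filter_upwards [h.potential_nonneg, ae_restrict_mem measurableSet_Ioo] with x hq hm
    have hx := Ioo_subset_Icc_self hm
    have hsc1 := Real.sin_sq_add_cos_sq (θ x)
    have hS0 := hSpos x hx
    have hb := modified_angle_deriv_bound (S' := S' x) hsc1 hk1 hS0 (h.tension_pos x hx) hq
      (Real.sq_sqrt (mul_pos (h.density_pos x hx) (h.tension_pos x hx)).le)
    rw [← modified_angle_deriv_eq hsc1 (by positivity), hkl] at hb
    simpa only [sub_zero] using hb) (right_mem_Icc.2 h.lt.le)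
  simp only [ha, Γa, Ga, Real.sin_zero, zero_mul, mul_zero, Real.arctan_zero, sub_zero,
    add_zero, hΓb] at key
  set X := Real.arctan _ with hXdef
  have hXle : |X| ≤ Real.pi / 2 := abs_le.2
    ⟨(Real.neg_pi_div_two_lt_arctan _).le, (Real.arctan_lt_pi_div_two _).le⟩
  rw [abs_le] at key hXle ⊢
  constructor <;> linarith [key.1, key.2, hXle.1, hXle.2]

end IsC1StringCoeff

/-! ### The effect of the point mass on the angle -/

/-- The angle `τ` near `θ` such that `(cos τ, sin τ)` is positively proportional to
`(cos θ - c sin θ, sin θ)`: the change of a Prüfer angle at a point mass. -/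
noncomputable def massAngle (θ c : ℝ) : ℝ :=
  θ + Complex.arg ⟨1 - c * (Real.sin θ * Real.cos θ), c * Real.sin θ ^ 2⟩

/-- The complex number is `exp (-iθ)` times `cos θ - c sin θ + i sin θ`. If its imaginary part
vanishes then `c` or `sin θ` is zero and its real part is `1`. Avoiding the cut is what makes
`massAngle` continuous. -/
lemma massAngle_complex_mem_slitPlane (θ c : ℝ) :
    (⟨1 - c * (Real.sin θ * Real.cos θ), c * Real.sin θ ^ 2⟩ : ℂ) ∈ Complex.slitPlane := by
  rw [Complex.mem_slitPlane_iff]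
  simp only
  by_cases h : c * Real.sin θ ^ 2 = 0
  · left
    rcases mul_eq_zero.1 h with h | h
    · simp [h]
    · simp [pow_eq_zero_iff two_ne_zero |>.1 h]
  · exact Or.inr h

@[simp] lemma massAngle_zero_right (θ : ℝ) : massAngle θ 0 = θ := by
  have : (⟨1, 0⟩ : ℂ) = 1 := rfl
  simp [massAngle, this]

lemma massAngle_of_sin_eq_zero {θ : ℝ} (c : ℝ) (h : Real.sin θ = 0) : massAngle θ c = θ := by
  have : (⟨1, 0⟩ : ℂ) = 1 := rfl
  simp [massAngle, h, this]

lemma exists_massAngle_polar (θ c : ℝ) :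
    ∃ r > 0, r * Real.cos (massAngle θ c) = Real.cos θ - c * Real.sin θ ∧
      r * Real.sin (massAngle θ c) = Real.sin θ := by
  set z : ℂ := ⟨1 - c * (Real.sin θ * Real.cos θ), c * Real.sin θ ^ 2⟩ with hz
  have h0 : z ≠ 0 := Complex.slitPlane_ne_zero (massAngle_complex_mem_slitPlane θ c)
  have h1 : ‖z‖ * Real.cos z.arg = 1 - c * (Real.sin θ * Real.cos θ) :=
    Complex.norm_mul_cos_arg z
  have h2 : ‖z‖ * Real.sin z.arg = c * Real.sin θ ^ 2 := Complex.norm_mul_sin_arg z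
  have h3 := Real.sin_sq_add_cos_sq θ
  refine ⟨‖z‖, norm_pos_iff.2 h0, ?_, ?_⟩
  · rw [massAngle, ← hz, Real.cos_add]
    linear_combination Real.cos θ * h1 - Real.sin θ * h2 - c * Real.sin θ * h3
  · rw [massAngle, ← hz, Real.sin_add]
    linear_combination Real.sin θ * h1 + Real.cos θ * h2

lemma continuous_massAngle : Continuous fun p : ℝ × ℝ => massAngle p.1 p.2 := by
  refine continuous_fst.add (continuous_iff_continuousAt.2 fun p => ?_)
  refine ContinuousAt.comp (g := Complex.arg)
    (Complex.continuousAt_arg (massAngle_complex_mem_slitPlane p.1 p.2)) ?_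
  have : Continuous fun p : ℝ × ℝ => (Complex.equivRealProdCLM.symm
      (1 - p.2 * (Real.sin p.1 * Real.cos p.1), p.2 * Real.sin p.1 ^ 2) : ℂ) := by fun_prop
  exact this.continuousAt

lemma massAngle_add_int_mul (θ c : ℝ) (n : ℤ) :
    massAngle (θ + n * (2 * Real.pi)) c = massAngle θ c + n * (2 * Real.pi) := by
  simp only [massAngle, Real.sin_add_int_mul_two_pi, Real.cos_add_int_mul_two_pi]
  ring

/-- A continuous injective function on the line is strictly monotone, and the fixed points `0` and
`π` decide the direction. Injectivity: the shear is an invertible linear map, so equal images come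
from unit vectors that are positively proportional, hence equal; a difference of `2πk` in the angle
survives in `massAngle`. -/
lemma strictMono_massAngle_left (c : ℝ) : StrictMono fun θ => massAngle θ c := by
  have hcont : Continuous fun θ => massAngle θ c :=
    continuous_massAngle.comp (continuous_id.prodMk continuous_const)
  have hinj : Function.Injective fun θ => massAngle θ c := by
    intro θ ψ h
    simp only at h
    obtain ⟨r, hr, h1, h2⟩ := exists_massAngle_polar θ c
    obtain ⟨t, ht, h3, h4⟩ := exists_massAngle_polar ψ c
    rw [← h] at h3 h4
    have e1 : r * Real.sin ψ = t * Real.sin θ := by rw [← h2, ← h4]; ring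
    have e2 : r * Real.cos ψ = t * Real.cos θ := by
      linear_combination c * e1 - r * h3 + t * h1
    have e3 : r ^ 2 = t ^ 2 := by
      linear_combination (r * Real.sin ψ + t * Real.sin θ) * e1 +
        (r * Real.cos ψ + t * Real.cos θ) * e2 - r ^ 2 * Real.sin_sq_add_cos_sq ψ +
        t ^ 2 * Real.sin_sq_add_cos_sq θ
    have e4 : r = t := (pow_left_inj₀ hr.le ht.le two_ne_zero).1 e3
    rw [← e4] at e1 e2
    have hs := mul_left_cancel₀ hr.ne' e1
    have hc := mul_left_cancel₀ hr.ne' e2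
    obtain ⟨k, hk⟩ := Real.Angle.angle_eq_iff_two_pi_dvd_sub.1 (Real.Angle.cos_sin_inj hc hs)
    have hk' : ψ = θ + k * (2 * Real.pi) := by linarith
    rw [hk', massAngle_add_int_mul] at h
    rw [hk']
    linarith
  rcases hcont.strictMono_of_inj hinj with h | h
  · exact h
  · have h1 := h Real.pi_pos
    simp only [massAngle_of_sin_eq_zero c Real.sin_pi, massAngle_of_sin_eq_zero c Real.sin_zero]
      at h1
    exact absurd h1 Real.pi_pos.not_gt

lemma lt_massAngle {θ c : ℝ} (hc : 0 < c) (hs : Real.sin θ ≠ 0) : θ < massAngle θ c := by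
  have h0 : 0 < c * Real.sin θ ^ 2 := by positivity
  have h1 : 0 ≤ Complex.arg ⟨1 - c * (Real.sin θ * Real.cos θ), c * Real.sin θ ^ 2⟩ :=
    Complex.arg_nonneg_iff.2 h0.le
  have h2 : Complex.arg ⟨1 - c * (Real.sin θ * Real.cos θ), c * Real.sin θ ^ 2⟩ ≠ 0 := by
    rw [Ne, Complex.arg_eq_zero_iff]
    exact fun h => h0.ne' h.2
  have := lt_of_le_of_ne h1 h2.symm
  rw [massAngle]
  linarith

/-- Again continuity and injectivity give monotonicity, the direction being decided by `c = 0` and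
`c = 1`. If `sin θ = 0` the shear has no effect at all. -/
lemma monotone_massAngle_right (θ : ℝ) : Monotone fun c => massAngle θ c := by
  by_cases hs : Real.sin θ = 0
  · simp only [massAngle_of_sin_eq_zero _ hs]
    exact monotone_const
  have hcont : Continuous fun c => massAngle θ c :=
    continuous_massAngle.comp (continuous_const.prodMk continuous_id)
  have hinj : Function.Injective fun c => massAngle θ c := by
    intro c d h
    simp only at h
    obtain ⟨r, hr, h1, h2⟩ := exists_massAngle_polar θ c
    obtain ⟨t, ht, h3, h4⟩ := exists_massAngle_polar θ d
    rw [← h] at h3 h4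
    have hs' : Real.sin (massAngle θ c) ≠ 0 := fun h0 => hs (by rw [← h2, h0, mul_zero])
    have e : r = t := mul_right_cancel₀ hs' (h2.trans h4.symm)
    rw [← e, h1] at h3
    exact mul_right_cancel₀ hs (by linarith)
  rcases hcont.strictMono_of_inj hinj with h | h
  · exact h.monotone
  · have h1 := h one_pos
    simp only [massAngle_zero_right] at h1
    exact absurd h1 (lt_massAngle one_pos hs).not_gt

lemma abs_massAngle_sub_le (θ c : ℝ) : |massAngle θ c - θ| ≤ Real.pi := by
  rw [massAngle, add_sub_cancel_left]
  exact Complex.abs_arg_le_pi _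

/-- The multiples of `π` are fixed and the map is increasing, so each interval `[kπ, (k+1)π)` is
mapped into itself. -/
lemma floor_massAngle_div_pi (θ c : ℝ) : ⌊massAngle θ c / Real.pi⌋ = ⌊θ / Real.pi⌋ := by
  rw [Int.floor_eq_iff]
  have h1 := (strictMono_massAngle_left c).monotone
    ((le_div_iff₀ Real.pi_pos).1 (Int.floor_le (θ / Real.pi)))
  have h2 := strictMono_massAngle_left c
    ((div_lt_iff₀ Real.pi_pos).1 (Int.lt_floor_add_one (θ / Real.pi)))
  have h3 : Real.sin ((⌊θ / Real.pi⌋ + 1) * Real.pi) = 0 := by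
    exact_mod_cast Real.sin_int_mul_pi (⌊θ / Real.pi⌋ + 1)
  simp only [massAngle_of_sin_eq_zero c (Real.sin_int_mul_pi _)] at h1
  simp only [massAngle_of_sin_eq_zero c h3] at h2
  exact ⟨(le_div_iff₀ Real.pi_pos).2 h1, (div_lt_iff₀ Real.pi_pos).2 h2⟩

lemma sin_massAngle_eq_zero_iff (θ c : ℝ) : Real.sin (massAngle θ c) = 0 ↔ Real.sin θ = 0 := by
  obtain ⟨r, hr, _, h2⟩ := exists_massAngle_polar θ c
  rw [← h2]
  simp [hr.ne']

/-! ### Multiplicities in terms of end angles -/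

lemma edim_eq_one {V : Type*} [AddCommGroup V] [Module ℝ V] {W : Submodule ℝ V} {v : V}
    (hv : v ∈ W) (h0 : v ≠ 0) (h : ∀ u ∈ W, ∃ c : ℝ, u = c • v) : edim W = 1 := by
  have e : W = Submodule.span ℝ {v} := by
    refine le_antisymm (fun u hu => ?_) (by simpa using hv)
    obtain ⟨c, rfl⟩ := h u hu
    exact Submodule.smul_mem _ c (Submodule.mem_span_singleton_self v)
  have h1 : Module.rank ℝ W = 1 := by
    rw [e, Module.rank_eq_one_iff_finrank_eq_one]
    exact finrank_span_singleton h0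
  simp [edim, h1]

lemma edim_eq_zero {V : Type*} [AddCommGroup V] [Module ℝ V] {W : Submodule ℝ V}
    (h : ∀ u ∈ W, u = 0) : edim W = 0 := by
  have e : W = ⊥ := (Submodule.eq_bot_iff W).2 h
  simp [edim, e]

/-- A solution vanishing at the end point `s`, spanning all such solutions, and with
angle `θ` at the other end point `t`; `ε = ±1` is the direction from `s` to `t`. -/
def HasEndAngle (a b : ℝ) (ρ σ q : ℝ → ℝ) (l s t ε θ : ℝ) : Prop :=
  ∃ φ ∈ stringSolutions a b ρ σ q l, φ s = 0 ∧ φ t = Real.sin θ ∧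
    σ t * derivWithin φ (Icc a b) t = ε * Real.cos θ ∧
    ∀ u ∈ stringSolutions a b ρ σ q l, u s = 0 → ∃ c : ℝ, u = c • φ

lemma exists_normalized {a b : ℝ} {ρ σ q : ℝ → ℝ} {l s t ε θ r : ℝ} (hr : 0 < r) {φ : ℝ → ℝ}
    (hφ : φ ∈ stringSolutions a b ρ σ q l) (ht : t ∈ Icc a b) (h1 : φ s = 0)
    (h2 : φ t = r * Real.sin θ) (h3 : σ t * derivWithin φ (Icc a b) t = ε * (r * Real.cos θ))
    (h4 : ∀ u ∈ stringSolutions a b ρ σ q l, u s = 0 → ∃ c : ℝ, u = c • φ) :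
    HasEndAngle a b ρ σ q l s t ε θ := by
  refine ⟨r⁻¹ • φ, Submodule.smul_mem _ _ hφ, by simp [h1], ?_, ?_, fun u hu hus => ?_⟩
  · simp only [Pi.smul_apply, smul_eq_mul, h2]
    field_simp
  · rw [derivWithin_const_smul r⁻¹ (stringSolutions_differentiableWithinAt hφ ht), smul_eq_mul]
    calc _ = r⁻¹ * (σ t * derivWithin φ (Icc a b) t) := by ring
      _ = _ := by rw [h3]; field_simp
  · obtain ⟨c, hc⟩ := h4 u hu hus
    exact ⟨c * r, by rw [smul_smul, mul_assoc, mul_inv_cancel₀ hr.ne', mul_one, hc]⟩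

/-- The properties of the Prüfer angle at an end point, as a function of the spectral parameter. -/
structure IsEndAngleFunction (γ : ℝ) (θ : ℝ → ℝ) : Prop where
  continuous : Continuous θ
  strictMono : StrictMono θ
  pos : ∀ l, 0 < θ l
  zero_lt : θ 0 < Real.pi / 2
  asymptotic : ∃ C : ℝ, ∀ l ≥ 1, |θ l - √l * γ| ≤ C

namespace IsC1StringCoeff

variable {a b : ℝ} {ρ σ q : ℝ → ℝ}

lemma isEndAngleFunction (h : IsC1StringCoeff a b ρ σ q) {θ : ℝ → ℝ → ℝ}
    (hθ : ∀ l, IsPruferAngle a b ρ σ q l (θ l)) (ha : ∀ l, θ l a = 0) :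
    IsEndAngleFunction (opticalLength a b ρ σ) fun l => θ l b where
  continuous := h.continuous_angle hθ ha
  strictMono l m hlm := h.angle_lt_angle (hθ l) (hθ m) (by rw [ha, ha]) hlm
  pos l := h.angle_pos (hθ l) (ha l)
  zero_lt := h.angle_zero_lt (hθ 0) (ha 0)
  asymptotic := by
    obtain ⟨C, hC⟩ := h.exists_abs_angle_sub_le
    exact ⟨C, fun l hl => hC l hl _ (hθ l) (ha l)⟩

theorem exists_left_endAngle (h : IsC1StringCoeff a b ρ σ q) :
    ∃ θ : ℝ → ℝ, IsEndAngleFunction (opticalLength a b ρ σ) θ ∧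
      ∀ l, HasEndAngle a b ρ σ q l a b 1 (θ l) := by
  choose θ hθ ha using fun l => h.exists_angle l 0
  refine ⟨_, h.isEndAngleFunction hθ ha, fun l => ?_⟩
  obtain ⟨φ, hφ, r, hr, h1, h2, h3, h4⟩ := h.exists_solution (hθ l) (ha l)
  exact exists_normalized hr hφ (right_mem_Icc.2 h.lt.le) h1 h2 (by rw [h3, one_mul]) h4

theorem exists_right_endAngle (h : IsC1StringCoeff a b ρ σ q) :
    ∃ θ : ℝ → ℝ, IsEndAngleFunction (opticalLength a b ρ σ) θ ∧
      ∀ l, HasEndAngle a b ρ σ q l b a (-1) (θ l) := by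
  choose θ hθ ha using fun l => h.comp_neg.exists_angle l 0
  have e : opticalLength (-b) (-a) (fun x => ρ (-x)) (fun x => σ (-x)) =
      opticalLength a b ρ σ := by
    simp only [opticalLength]
    rw [intervalIntegral.integral_comp_neg fun x => √(ρ x / σ x)]
    simp
  refine ⟨_, e ▸ h.comp_neg.isEndAngleFunction hθ ha, fun l => ?_⟩
  obtain ⟨φ, hφ, r, hr, h1, h2, h3, h4⟩ := h.exists_solution_right (hθ l) (ha l)
  exact exists_normalized hr hφ (left_mem_Icc.2 h.lt.le) h1 h2 (by rw [h3]; ring) h4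

end IsC1StringCoeff

namespace HasEndAngle

open Classical in
lemma edim_eq {a b : ℝ} {ρ σ q : ℝ → ℝ} {l s t ε θ : ℝ} (h : HasEndAngle a b ρ σ q l s t ε θ)
    (hε : ε ≠ 0) {W : Submodule ℝ (ℝ → ℝ)}
    (hW : ∀ u, u ∈ W ↔ u ∈ stringSolutions a b ρ σ q l ∧ u s = 0 ∧ u t = 0) :
    edim W = if Real.sin θ = 0 then 1 else 0 := by
  obtain ⟨φ, hφ, h1, h2, h3, h4⟩ := h
  split_ifs with hs
  · refine edim_eq_one ((hW φ).2 ⟨hφ, h1, h2.trans hs⟩) (fun h0 => ?_)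
      fun u hu => h4 u ((hW u).1 hu).1 ((hW u).1 hu).2.1
    rw [h0, derivWithin_zero] at h3
    have hc : Real.cos θ = 0 := by simpa [hε] using h3.symm
    have := Real.sin_sq_add_cos_sq θ
    simp [hs, hc] at this
  · refine edim_eq_zero fun u hu => ?_
    obtain ⟨c, rfl⟩ := h4 u ((hW u).1 hu).1 ((hW u).1 hu).2.1
    have h5 := ((hW _).1 hu).2.2
    simp only [Pi.smul_apply, smul_eq_mul, h2, mul_eq_zero, hs, or_false] at h5
    rw [h5, zero_smul]

open Classical in
lemma edim_dirichlet_left {a b : ℝ} {ρ σ q : ℝ → ℝ} {l θ : ℝ}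
    (h : HasEndAngle a b ρ σ q l a b 1 θ) :
    edim (dirichletEigenspace a b ρ σ q l) = if Real.sin θ = 0 then 1 else 0 :=
  h.edim_eq one_ne_zero fun _ => Iff.rfl

open Classical in
lemma edim_dirichlet_right {a b : ℝ} {ρ σ q : ℝ → ℝ} {l θ : ℝ}
    (h : HasEndAngle a b ρ σ q l b a (-1) θ) :
    edim (dirichletEigenspace a b ρ σ q l) = if Real.sin θ = 0 then 1 else 0 :=
  h.edim_eq (by norm_num) fun _ => and_congr_right fun _ => and_comm

open Classical in
-- Every candidate is `(A φ, B ψ)`. The conditions at `0` say that `A r (sin τ, cos τ)` equals `B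
-- (sin β, -cos β)`, a linear system in `A`, `B` that is singular exactly when `sin (τ + β) = 0`.
-- Both vectors being nonzero, its kernel is then a line.
lemma edim_joined {ρ₁ σ₁ q₁ ρ₂ σ₂ q₂ : ℝ → ℝ} {l M α β : ℝ}
    (h₁ : HasEndAngle (-1) 0 ρ₁ σ₁ q₁ l (-1) 0 1 α)
    (h₂ : HasEndAngle 0 1 ρ₂ σ₂ q₂ l 1 0 (-1) β) :
    edim (joinedEigenspace ρ₁ σ₁ q₁ ρ₂ σ₂ q₂ M l) =
      if Real.sin (massAngle α (l * M) + β) = 0 then 1 else 0 := by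
  obtain ⟨φ, hφ, p1, p2, p3, p4⟩ := h₁
  obtain ⟨ψ, hψ, s1, s2, s3, s4⟩ := h₂
  obtain ⟨r, hr, e1, e2⟩ := exists_massAngle_polar α (l * M)
  set τ := massAngle α (l * M) with hτ
  have hsc := Real.sin_sq_add_cos_sq β
  have hcomb (A B : ℝ) : (A • φ, B • ψ) ∈ joinedEigenspace ρ₁ σ₁ q₁ ρ₂ σ₂ q₂ M l ↔
      A * Real.sin α = B * Real.sin β ∧
      A * Real.cos α + B * Real.cos β = l * M * (A * Real.sin α) := by
    have d1 := derivWithin_const_smul A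
      (stringSolutions_differentiableWithinAt hφ (right_mem_Icc.2 (by norm_num)))
    have d2 := derivWithin_const_smul B
      (stringSolutions_differentiableWithinAt hψ (left_mem_Icc.2 (by norm_num)))
    constructor
    · rintro ⟨_, _, _, _, hc, hd⟩
      simp only [Pi.smul_apply, smul_eq_mul, p2, s2] at hc hd
      rw [d1, d2, smul_eq_mul, smul_eq_mul] at hd
      exact ⟨hc, by linear_combination hd - A * p3 + B * s3⟩
    · rintro ⟨hc, hd⟩
      refine ⟨Submodule.smul_mem _ _ hφ, Submodule.smul_mem _ _ hψ, by simp [p1], by simp [s1],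
        by simp [p2, s2, hc], ?_⟩
      simp only [Pi.smul_apply, smul_eq_mul, p2]
      rw [d1, d2, smul_eq_mul, smul_eq_mul]
      linear_combination hd + A * p3 - B * s3
  have hall (u) (hu : u ∈ joinedEigenspace ρ₁ σ₁ q₁ ρ₂ σ₂ q₂ M l) :
      ∃ A B : ℝ, u = (A • φ, B • ψ) := by
    obtain ⟨A, hA⟩ := p4 u.1 hu.1 hu.2.2.1
    obtain ⟨B, hB⟩ := s4 u.2 hu.2.1 hu.2.2.2.1
    exact ⟨A, B, Prod.ext hA hB⟩
  have hcomb' (A B : ℝ) : (A * Real.sin α = B * Real.sin β ∧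
      A * Real.cos α + B * Real.cos β = l * M * (A * Real.sin α)) ↔
      (A * r * Real.sin τ = B * Real.sin β ∧ A * r * Real.cos τ + B * Real.cos β = 0) := by
    rw [mul_assoc A r, mul_assoc A r, e1, e2]
    refine and_congr_right fun _ => ?_
    constructor <;> intro h <;> linear_combination h
  split_ifs with hs
  -- When `sin (τ + β) = 0`, this is the sign `±1` relating the data at angle `τ` to those at `-β`.
  · set δ := Real.cos (τ + β) with hδ
    have hδ2 : δ ^ 2 = 1 := by
      have := Real.sin_sq_add_cos_sq (τ + β)
      rw [hs] at this
      linarith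
    have hsin : Real.sin τ = -δ * Real.sin β := by
      have : τ = τ + β - β := by ring
      rw [this, Real.sin_sub, hs]; ring
    have hcos : Real.cos τ = δ * Real.cos β := by
      have : τ = τ + β - β := by ring
      rw [this, Real.cos_sub, hs]; ring
    have hmem : (r⁻¹ • φ, (-δ) • ψ) ∈ joinedEigenspace ρ₁ σ₁ q₁ ρ₂ σ₂ q₂ M l := by
      rw [hcomb, hcomb', inv_mul_cancel₀ hr.ne', hsin, hcos]
      constructor <;> ring
    refine edim_eq_one hmem (fun h0 => ?_) fun u hu => ?_
    · have hψ0 : (-δ) • ψ = 0 := congrArg Prod.snd h0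
      have hδ0 : δ ≠ 0 := fun h => by simp [h] at hδ2
      have hψ1 : ψ = 0 := (smul_eq_zero.1 hψ0).resolve_left (neg_ne_zero.2 hδ0)
      rw [hψ1, derivWithin_zero] at s3
      rw [hψ1] at s2
      have h5 : Real.cos β = 0 := by simpa using s3
      have h6 : Real.sin β = 0 := s2.symm
      simp [h5, h6] at hsc
    · obtain ⟨A, B, rfl⟩ := hall u hu
      rw [hcomb, hcomb', hsin, hcos] at hu
      refine ⟨A * r, ?_⟩
      have hB : B = A * r * -δ := by
        linear_combination (-B - A * r * δ) * hsc - Real.sin β * hu.1 + Real.cos β * hu.2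
      rw [Prod.smul_mk, smul_smul, smul_smul, mul_assoc A, mul_inv_cancel₀ hr.ne', mul_one, hB]
  · refine edim_eq_zero fun u hu => ?_
    obtain ⟨A, B, rfl⟩ := hall u hu
    rw [hcomb, hcomb'] at hu
    have hA : A * r * Real.sin (τ + β) = 0 := by
      rw [Real.sin_add]
      linear_combination Real.cos β * hu.1 + Real.sin β * hu.2
    have hA0 : A = 0 := by simpa [hr.ne', hs] using hA
    rw [hA0] at hu
    have hB : B = 0 := by
      linear_combination (-B) * hsc - Real.sin β * hu.1 + Real.cos β * hu.2
    simp [hA0, hB]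

end HasEndAngle

/-! ### From counting functions to listings -/

/-- A right continuous counting function `N` with left limits `L` determines a listing `s`. -/
lemma exists_seq_of_count {N L : ℝ → ℤ} (hN : Monotone N) (h0 : ∃ x, N x ≤ 0)
    (htop : ∀ n : ℤ, ∃ x, n < N x) (hr : ∀ x, ∀ᶠ y in 𝓝[>] x, N y = N x)
    (hl : ∀ x, ∀ᶠ y in 𝓝[<] x, N y = L x) :
    ∃ s : ℕ → ℝ, (∀ n x, s n ≤ x ↔ (n : ℤ) < N x) ∧ ∀ n x, s n < x ↔ (n : ℤ) < L x := by
  obtain ⟨x0, hx0⟩ := h0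
  have hne (n : ℕ) : {x | (n : ℤ) < N x}.Nonempty := htop n
  have hbdd (n : ℕ) : BddBelow {x | (n : ℤ) < N x} := by
    refine ⟨x0, fun x hx => ?_⟩
    by_contra hlt
    have := hN (not_le.1 hlt).le
    have hx' : (n : ℤ) < N x := hx
    omega
  -- Right continuity of `N` makes the infimum a minimum.
  have hle (n : ℕ) (x : ℝ) : sInf {x | (n : ℤ) < N x} ≤ x ↔ (n : ℤ) < N x := by
    refine ⟨fun h => ?_, fun h => csInf_le (hbdd n) h⟩
    obtain ⟨y, hy, hxy⟩ := ((hr x).and self_mem_nhdsWithin).exists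
    obtain ⟨z, hz, hzy⟩ := (csInf_lt_iff (hbdd n) (hne n)).1 (h.trans_lt hxy)
    have hz' : (n : ℤ) < N z := hz
    have := hN hzy.le
    omega
  refine ⟨fun n => sInf {x | (n : ℤ) < N x}, hle, fun n x => ⟨fun h => ?_, fun h => ?_⟩⟩
  · obtain ⟨y, hy, hy1⟩ := ((hl x).and (Ioo_mem_nhdsLT h)).exists
    rw [← hy]
    exact (hle n y).1 hy1.1.le
  · obtain ⟨y, hy, hy1⟩ := ((hl x).and self_mem_nhdsWithin).exists
    rw [← hy, ← hle] at h
    exact h.trans_lt hy1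

/-- The indices with `s n = x` are those with `L x ≤ n < N x`; as `L x ≥ 0`, none is lost in passing
from integers to natural numbers. -/
lemma isListing_of_count {N L : ℝ → ℤ} {s : ℕ → ℝ} {m : ℝ → ℕ∞}
    (hs : ∀ n x, s n ≤ x ↔ (n : ℤ) < N x) (hs' : ∀ n x, s n < x ↔ (n : ℤ) < L x)
    (hL : ∀ x, 0 ≤ L x) (hm : ∀ x, m x = ((N x - L x).toNat : ℕ∞)) : IsListing m s := by
  refine ⟨monotone_nat_of_le_succ fun n => ?_, fun x => ?_⟩
  · rw [hs]
    have := (hs (n + 1) (s (n + 1))).1 le_rfl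
    push_cast at this
    omega
  · have e : {n : ℕ | s n = x} = (Finset.Ico (L x).toNat (N x).toNat : Finset ℕ) := by
      ext n
      have h1 := hs n x
      have h2 := hs' n x
      have h3 := hL x
      simp only [mem_ofPred_eq, Finset.coe_Ico, mem_Ico]
      rw [le_antisymm_iff, h1, ← not_lt (b := x), h2]
      omega
    rw [e, Set.encard_coe_eq_coe_finsetCard, hm, Nat.card_Ico]
    have h3 := hL x
    congr 1
    omega

lemma eventually_floor_right {f : ℝ → ℝ} (hf : Continuous f) (hm : StrictMono f) (x : ℝ) :
    ∀ᶠ y in 𝓝[>] x, ⌊f y⌋ = ⌊f x⌋ := by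
  have h1 : Tendsto f (𝓝[>] x) (𝓝[≥] f x) := by
    refine tendsto_nhdsWithin_iff.2 ⟨(hf.tendsto x).mono_left nhdsWithin_le_nhds, ?_⟩
    filter_upwards [self_mem_nhdsWithin] with y hy using (hm hy).le
  exact tendsto_pure.1 ((tendsto_floor_right_pure_floor (f x)).comp h1)

lemma eventually_floor_left {f : ℝ → ℝ} (hf : Continuous f) (hm : StrictMono f) (x : ℝ) :
    ∀ᶠ y in 𝓝[<] x, ⌊f y⌋ = ⌈f x⌉ - 1 := by
  have h1 : Tendsto f (𝓝[<] x) (𝓝[<] f x) := by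
    refine tendsto_nhdsWithin_iff.2 ⟨(hf.tendsto x).mono_left nhdsWithin_le_nhds, ?_⟩
    filter_upwards [self_mem_nhdsWithin] with y hy using hm hy
  exact tendsto_pure.1 ((tendsto_floor_left_pure_ceil_sub_one (f x)).comp h1)

lemma sin_eq_zero_iff_exists_div_pi {x : ℝ} :
    Real.sin x = 0 ↔ ∃ n : ℤ, x / Real.pi = n := by
  rw [Real.sin_eq_zero_iff]
  refine exists_congr fun n => ?_
  rw [div_eq_iff Real.pi_ne_zero, eq_comm]

open Classical in
lemma floor_sub_ceil_div_pi (x : ℝ) :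
    ⌊x / Real.pi⌋ - (⌈x / Real.pi⌉ - 1) = if Real.sin x = 0 then 1 else 0 := by
  split_ifs with h
  · obtain ⟨n, hn⟩ := sin_eq_zero_iff_exists_div_pi.1 h
    rw [hn, Int.floor_intCast, Int.ceil_intCast]
    ring
  · have h1 : (⌊x / Real.pi⌋ : ℝ) < x / Real.pi :=
      lt_of_le_of_ne (Int.floor_le _) fun e => h (sin_eq_zero_iff_exists_div_pi.2 ⟨_, e.symm⟩)
    have h2 : ⌈x / Real.pi⌉ = ⌊x / Real.pi⌋ + 1 := by
      rw [Int.ceil_eq_iff]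
      push_cast
      exact ⟨by linarith, (Int.lt_floor_add_one _).le⟩
    rw [h2]
    ring

lemma one_le_ceil_div_pi {x : ℝ} (hx : 0 < x) : 1 ≤ ⌈x / Real.pi⌉ :=
  Int.one_le_ceil_iff.2 (div_pos hx Real.pi_pos)

lemma floor_div_pi_eq_zero {x : ℝ} (h0 : 0 < x) (h1 : x < Real.pi) : ⌊x / Real.pi⌋ = 0 := by
  rw [Int.floor_eq_zero_iff]
  exact ⟨(div_pos h0 Real.pi_pos).le, (div_lt_one Real.pi_pos).2 h1⟩

open Classical in
/-- The listing of the parameters at which an increasing angle is a multiple of `π`. -/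
lemma exists_listing_of_angle {Θ : ℝ → ℝ} {m : ℝ → ℕ∞} (hc : Continuous Θ) (hm : StrictMono Θ)
    (hpos : ∀ x, 0 < Θ x) (h0 : Θ 0 < Real.pi) (htop : Tendsto Θ atTop atTop)
    (hmult : ∀ x, m x = if Real.sin (Θ x) = 0 then 1 else 0) :
    ∃ s : ℕ → ℝ, IsListing m s ∧ ∀ n, Θ (s n) = (n + 1) * Real.pi := by
  have hc' : Continuous fun x => Θ x / Real.pi := hc.div_const _
  have hm' : StrictMono fun x => Θ x / Real.pi := hm.div_const Real.pi_pos
  obtain ⟨s, hs, hs'⟩ := exists_seq_of_count (N := fun x => ⌊Θ x / Real.pi⌋)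
    (L := fun x => ⌈Θ x / Real.pi⌉ - 1) (fun x y h => Int.floor_mono (hm'.monotone h))
    ⟨0, (floor_div_pi_eq_zero (hpos 0) h0).le⟩
    (fun n => by
      obtain ⟨x, hx⟩ := (htop.eventually_ge_atTop ((n + 1) * Real.pi)).exists
      refine ⟨x, Int.lt_iff_add_one_le.2 (Int.le_floor.2 ?_)⟩
      push_cast
      rwa [le_div_iff₀ Real.pi_pos])
    (eventually_floor_right hc' hm') (eventually_floor_left hc' hm')
  refine ⟨s, isListing_of_count hs hs' (fun x => by linarith [one_le_ceil_div_pi (hpos x)])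
    fun x => ?_, fun n => ?_⟩
  · rw [hmult, floor_sub_ceil_div_pi]
    split_ifs <;> rfl
  -- The counts at `s n` itself, up to and strictly below it, squeeze `Θ (s n) / π` to `n + 1`. The
  -- shift by one appears because `Θ > 0` never takes the value `0 · π`.
  · have h1 := (hs n (s n)).1 le_rfl
    have h2 := mt (hs' n (s n)).2 (lt_irrefl _)
    have h3 := Int.le_floor.1 (Int.add_one_le_iff.2 h1)
    have h4 : ⌈Θ (s n) / Real.pi⌉ ≤ n + 1 := by linarith [not_lt.1 h2]
    have h5 := Int.ceil_le.1 h4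
    push_cast at h3 h5
    rw [← div_eq_iff Real.pi_ne_zero]
    exact le_antisymm h5 h3

open Classical in
/-- The listing of the parameters at which one of two increasing angles is a multiple of `π`. -/
lemma exists_listing_of_two_angles {α β : ℝ → ℝ} {m : ℝ → ℕ∞} (hα : Continuous α)
    (hβ : Continuous β) (hα' : StrictMono α) (hβ' : StrictMono β) (pα : ∀ x, 0 < α x)
    (pβ : ∀ x, 0 < β x) (α0 : α 0 < Real.pi) (β0 : β 0 < Real.pi)
    (htop : Tendsto α atTop atTop)
    (hmult : ∀ x, m x = (if Real.sin (α x) = 0 then 1 else 0) +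
      (if Real.sin (β x) = 0 then 1 else 0)) :
    ∃ s : ℕ → ℝ, IsListing m s ∧
      (∀ n x, s n ≤ x ↔ (n : ℤ) < ⌊α x / Real.pi⌋ + ⌊β x / Real.pi⌋) ∧
      ∀ n x, s n < x ↔ (n : ℤ) < (⌈α x / Real.pi⌉ - 1) + (⌈β x / Real.pi⌉ - 1) := by
  have cα : Continuous fun x => α x / Real.pi := hα.div_const _
  have mα : StrictMono fun x => α x / Real.pi := hα'.div_const Real.pi_pos
  have cβ : Continuous fun x => β x / Real.pi := hβ.div_const _
  have mβ : StrictMono fun x => β x / Real.pi := hβ'.div_const Real.pi_pos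
  obtain ⟨s, hs, hs'⟩ := exists_seq_of_count
    (N := fun x => ⌊α x / Real.pi⌋ + ⌊β x / Real.pi⌋)
    (L := fun x => (⌈α x / Real.pi⌉ - 1) + (⌈β x / Real.pi⌉ - 1))
    (fun x y h => add_le_add (Int.floor_mono (mα.monotone h)) (Int.floor_mono (mβ.monotone h)))
    ⟨0, by simp only [floor_div_pi_eq_zero (pα 0) α0, floor_div_pi_eq_zero (pβ 0) β0]; rfl⟩
    (fun n => by
      obtain ⟨x, hx⟩ := (htop.eventually_ge_atTop ((n + 1) * Real.pi)).exists
      refine ⟨x, ?_⟩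
      have h1 : n + 1 ≤ ⌊α x / Real.pi⌋ := Int.le_floor.2 (by
        push_cast
        rwa [le_div_iff₀ Real.pi_pos])
      have h2 : 0 ≤ ⌊β x / Real.pi⌋ := Int.floor_nonneg.2 (div_pos (pβ x) Real.pi_pos).le
      omega)
    (fun x => by
      filter_upwards [eventually_floor_right cα mα x, eventually_floor_right cβ mβ x]
        with y h1 h2
      rw [h1, h2])
    (fun x => by
      filter_upwards [eventually_floor_left cα mα x, eventually_floor_left cβ mβ x]
        with y h1 h2
      rw [h1, h2])
  refine ⟨s, isListing_of_count hs hs' (fun x => ?_) fun x => ?_, hs, hs'⟩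
  · linarith [one_le_ceil_div_pi (pα x), one_le_ceil_div_pi (pβ x)]
  · have h1 := floor_sub_ceil_div_pi (α x)
    have h2 := floor_sub_ceil_div_pi (β x)
    have h3 : ⌊α x / Real.pi⌋ + ⌊β x / Real.pi⌋ -
        ((⌈α x / Real.pi⌉ - 1) + (⌈β x / Real.pi⌉ - 1)) =
        (if Real.sin (α x) = 0 then 1 else 0) + (if Real.sin (β x) = 0 then 1 else 0) := by
      rw [← h1, ← h2]; ring
    rw [hmult, h3]
    split_ifs <;> rfl

/-! ### Interlacing and asymptotics -/

/-- At a multiple of `π` of `α + β`, either both angles are multiples of `π`, or neither is. -/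
lemma angles_of_add_eq {α β : ℝ} {n : ℕ} (h : α + β = (n + 1) * Real.pi) :
    (Real.sin α = 0 ∧ Real.sin β = 0 ∧
      (⌈α / Real.pi⌉ - 1) + (⌈β / Real.pi⌉ - 1) = (n : ℤ) - 1 ∧
      ⌊α / Real.pi⌋ + ⌊β / Real.pi⌋ = (n : ℤ) + 1) ∨
    (Real.sin α ≠ 0 ∧ (⌈α / Real.pi⌉ - 1) + (⌈β / Real.pi⌉ - 1) = (n : ℤ) ∧
      ⌊α / Real.pi⌋ + ⌊β / Real.pi⌋ = (n : ℤ)) := by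
  have hβ : β / Real.pi = (n : ℝ) + 1 - α / Real.pi := by
    rw [eq_sub_iff_add_eq, ← add_div, div_eq_iff Real.pi_ne_zero]
    linarith
  have hf : ⌊β / Real.pi⌋ = (n : ℤ) + 1 - ⌈α / Real.pi⌉ := by
    have : β / Real.pi = -(α / Real.pi) + ((n + 1 : ℤ) : ℝ) := by rw [hβ]; push_cast; ring
    rw [this, Int.floor_add_intCast, Int.floor_neg]
    ring
  have hc : ⌈β / Real.pi⌉ = (n : ℤ) + 1 - ⌊α / Real.pi⌋ := by
    have : β / Real.pi = -(α / Real.pi) + ((n + 1 : ℤ) : ℝ) := by rw [hβ]; push_cast; ring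
    rw [this, Int.ceil_add_intCast, Int.ceil_neg]
    ring
  have key := floor_sub_ceil_div_pi α
  by_cases hs : Real.sin α = 0
  · left
    rw [if_pos hs] at key
    obtain ⟨k, hk⟩ := sin_eq_zero_iff_exists_div_pi.1 hs
    refine ⟨hs, sin_eq_zero_iff_exists_div_pi.2
      ⟨n + 1 - k, by rw [hβ, hk]; push_cast; ring⟩, ?_, ?_⟩
    · rw [hc]; linarith
    · rw [hf]; linarith
  · right
    rw [if_neg hs] at key
    refine ⟨hs, ?_, ?_⟩
    · rw [hc]; linarith
    · rw [hf]; linarith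

/-- A bounded error is negligible against a main term tending to infinity, and equivalence survives
squaring; the square of `√(s n)` is `s n` once `s n ≥ 0`. -/
lemma isEquivalent_sq_of_abs_sqrt_sub_le {s : ℕ → ℝ} {γ C : ℝ} (hγ : 0 < γ)
    (hs : Tendsto s atTop atTop)
    (h : ∀ᶠ n : ℕ in atTop, |((n : ℝ) + 1) * Real.pi - √(s n) * γ| ≤ C) :
    s ~[atTop] fun n : ℕ => (((n : ℝ) + 1) * Real.pi / γ) ^ 2 := by
  have htop : Tendsto (fun n : ℕ => ((n : ℝ) + 1) * Real.pi / γ) atTop atTop :=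
    ((tendsto_atTop_add_const_right _ _ tendsto_natCast_atTop_atTop).atTop_mul_const
      Real.pi_pos).atTop_div_const hγ
  have h1 : (fun n => √(s n)) ~[atTop] fun n : ℕ => ((n : ℝ) + 1) * Real.pi / γ := by
    have h2 : ((fun n => √(s n)) - fun n : ℕ => ((n : ℝ) + 1) * Real.pi / γ)
        =O[atTop] fun _ => (1 : ℝ) := by
      refine IsBigO.of_bound (C / γ) ?_
      filter_upwards [h] with n hn
      have e : √(s n) - ((n : ℝ) + 1) * Real.pi / γ =
          -(((n : ℝ) + 1) * Real.pi - √(s n) * γ) / γ := by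
        field_simp
        ring
      simp only [Pi.sub_apply, norm_one, mul_one]
      rw [e, Real.norm_eq_abs, abs_div, abs_neg, abs_of_pos hγ]
      gcongr
    refine h2.trans_isLittleO ?_
    rw [isLittleO_const_left]
    exact Or.inr (tendsto_norm_atTop_atTop.comp htop)
  refine (h1.pow 2).congr_left ?_
  filter_upwards [hs.eventually_ge_atTop 0] with n hn
  simp [Real.sq_sqrt hn]

lemma IsEndAngleFunction.tendsto {γ : ℝ} {θ : ℝ → ℝ} (h : IsEndAngleFunction γ θ) (hγ : 0 < γ) :
    Tendsto θ atTop atTop := by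
  obtain ⟨C, hC⟩ := h.asymptotic
  have h1 : Tendsto (fun l => √l * γ + -C) atTop atTop :=
    tendsto_atTop_add_const_right _ _ (Real.tendsto_sqrt_atTop.atTop_mul_const hγ)
  refine tendsto_atTop_mono' _ ?_ h1
  filter_upwards [eventually_ge_atTop 1] with l hl
  linarith [(abs_le.1 (hC l hl)).1]

theorem proposition3p4 (ρ₁ σ₁ q₁ ρ₂ σ₂ q₂ : ℝ → ℝ) (M : ℝ)
    (h₁ : IsStringCoeff (-1) 0 ρ₁ σ₁ q₁) (h₂ : IsStringCoeff 0 1 ρ₂ σ₂ q₂) (hM : 0 < M) :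
    ∃ lam lam' mu : ℕ → ℝ,
      IsListing (fun x => edim (joinedEigenspace ρ₁ σ₁ q₁ ρ₂ σ₂ q₂ M x)) lam ∧
      IsListing (fun x => edim (joinedEigenspace ρ₁ σ₁ q₁ ρ₂ σ₂ q₂ 0 x)) lam' ∧
      IsListing (fun x => edim (dirichletEigenspace (-1) 0 ρ₁ σ₁ q₁ x) +
        edim (dirichletEigenspace 0 1 ρ₂ σ₂ q₂ x)) mu ∧
      (lam 0 < lam' 0 ∧ lam' 0 < mu 0) ∧
      (∀ n : ℕ, mu n ≠ mu (n + 1) →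
        mu n < lam (n + 1) ∧ lam (n + 1) < lam' (n + 1) ∧ lam' (n + 1) < mu (n + 1)) ∧
      (∀ n : ℕ, mu n = mu (n + 1) →
        mu n = lam (n + 1) ∧ lam (n + 1) = lam' (n + 1)) ∧
      lam ~[atTop] fun n : ℕ =>
        (((n : ℝ) + 1) * Real.pi / (opticalLength (-1) 0 ρ₁ σ₁ + opticalLength 0 1 ρ₂ σ₂)) ^ 2 := by
  classical
  have c₁ := h₁.isC1StringCoeff (by norm_num)
  have c₂ := h₂.isC1StringCoeff (by norm_num)
  obtain ⟨α, hα, eα⟩ := c₁.exists_left_endAngle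
  obtain ⟨β, hβ, eβ⟩ := c₂.exists_right_endAngle
  have γ₁ := c₁.opticalLength_pos
  have γ₂ := c₂.opticalLength_pos
  have tα := hα.tendsto γ₁
  have tβ := hβ.tendsto γ₂
  set τ : ℝ → ℝ := fun l => massAngle (α l) (l * M) with hτ
  -- Strictness comes from `α`; growth of the mass term `l M` can only advance the angle further.
  have hτmono : StrictMono τ := fun l m hlm =>
    (strictMono_massAngle_left (l * M) (hα.strictMono hlm)).trans_le
      (monotone_massAngle_right (α m) (mul_le_mul_of_nonneg_right hlm.le hM.le))
  have hτcont : Continuous τ :=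
    continuous_massAngle.comp (hα.continuous.prodMk (continuous_id.mul continuous_const))
  have hτpos (l : ℝ) : 0 < τ l := by
    have := strictMono_massAngle_left (l * M) (hα.pos l)
    simpa only [massAngle_of_sin_eq_zero _ Real.sin_zero] using this
  have hτ0 : τ 0 = α 0 := by simp [hτ]
  have hτle (l : ℝ) : |τ l - α l| ≤ Real.pi := abs_massAngle_sub_le _ _
  have hτtop : Tendsto τ atTop atTop := by
    refine tendsto_atTop_mono (fun l => ?_)
      (tendsto_atTop_add_const_right _ (-Real.pi) tα)
    linarith [(abs_le.1 (hτle l)).1]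
  obtain ⟨lam, hlam, elam⟩ := exists_listing_of_angle
    (m := fun x => edim (joinedEigenspace ρ₁ σ₁ q₁ ρ₂ σ₂ q₂ M x))
    (hτcont.add hβ.continuous) (hτmono.add hβ.strictMono) (fun x => add_pos (hτpos x) (hβ.pos x))
    (by rw [Pi.add_apply, hτ0]; linarith [hα.zero_lt, hβ.zero_lt])
    (hτtop.atTop_add_atTop tβ) (fun x => (eα x).edim_joined (eβ x))
  obtain ⟨lam', hlam', elam'⟩ := exists_listing_of_angle
    (m := fun x => edim (joinedEigenspace ρ₁ σ₁ q₁ ρ₂ σ₂ q₂ 0 x))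
    (hα.continuous.add hβ.continuous) (hα.strictMono.add hβ.strictMono)
    (fun x => add_pos (hα.pos x) (hβ.pos x))
    (by rw [Pi.add_apply]; linarith [hα.zero_lt, hβ.zero_lt])
    (tα.atTop_add_atTop tβ)
    (fun x => by
      simpa only [mul_zero, massAngle_zero_right] using! (eα x).edim_joined (eβ x) (M := 0))
  obtain ⟨mu, hmu, mu_le, mu_lt⟩ := exists_listing_of_two_angles
    (m := fun x => edim (dirichletEigenspace (-1) 0 ρ₁ σ₁ q₁ x) +
      edim (dirichletEigenspace 0 1 ρ₂ σ₂ q₂ x))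
    hα.continuous hβ.continuous hα.strictMono hβ.strictMono hα.pos hβ.pos
    (by linarith [hα.zero_lt, Real.pi_pos]) (by linarith [hβ.zero_lt, Real.pi_pos]) tα
    (fun x => by rw [(eα x).edim_dirichlet_left, (eβ x).edim_dirichlet_right])
  simp only [Pi.add_apply] at elam elam'
  have hτmono' := (hτmono.add hβ.strictMono)
  -- The total angle is below `π` at `l = 0`. Positivity matters because the mass advances the angle
  -- only for `l > 0`.
  have hlam_pos (n : ℕ) : 0 < lam n := by
    rw [← hτmono'.lt_iff_lt, elam, hτ0]
    have : (0 : ℝ) ≤ n := n.cast_nonneg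
    nlinarith [hα.zero_lt, hβ.zero_lt, Real.pi_pos]
  have hlam'_pos (n : ℕ) : 0 < lam' n := by
    rw [← (hα.strictMono.add hβ.strictMono).lt_iff_lt, elam']
    have : (0 : ℝ) ≤ n := n.cast_nonneg
    nlinarith [hα.zero_lt, hβ.zero_lt, Real.pi_pos]
  have hceil (l : ℝ) : ⌈τ l / Real.pi⌉ = ⌈α l / Real.pi⌉ := by
    have e1 := floor_sub_ceil_div_pi (τ l)
    have e2 := floor_sub_ceil_div_pi (α l)
    have e3 : ⌊τ l / Real.pi⌋ = ⌊α l / Real.pi⌋ := floor_massAngle_div_pi _ _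
    have e4 : Real.sin (τ l) = 0 ↔ Real.sin (α l) = 0 := sin_massAngle_eq_zero_iff _ _
    simp only [e4] at e1
    rw [← e2, e3] at e1
    linarith
  have hfloor (l : ℝ) : ⌊τ l / Real.pi⌋ = ⌊α l / Real.pi⌋ := floor_massAngle_div_pi _ _
  -- the two alternatives at the `n`-th eigenvalues
  have alt (n : ℕ) :
      (1 ≤ n ∧ lam n = lam' n ∧ ∀ k, k + 1 = n → mu k = lam n ∧ mu n = lam n) ∨
      (lam n < lam' n ∧ lam' n < mu n ∧ ∀ k, k + 1 = n → mu k < lam n) := by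
    rcases angles_of_add_eq (elam n) with ⟨s1, s2, s3, s4⟩ | ⟨s1, s2, s3⟩
    · left
      rw [hceil] at s3
      rw [hfloor] at s4
      have s1' : Real.sin (α (lam n)) = 0 := (sin_massAngle_eq_zero_iff _ _).1 s1
      have e : lam n = lam' n := by
        refine (hα.strictMono.add hβ.strictMono).injective ?_
        rw [elam', ← elam]
        simp only [hτ, massAngle_of_sin_eq_zero _ s1']
      -- At `lam n` there are `n - 1` Dirichlet eigenvalues strictly below and `n + 1` up to the
      -- point, so those of index `n - 1` and `n` coincide with it. A count is nonnegative, which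
      -- excludes `n = 0`.
      have g1 := one_le_ceil_div_pi (hα.pos (lam n))
      have g2 := one_le_ceil_div_pi (hβ.pos (lam n))
      refine ⟨by omega, e, fun k hk => ⟨le_antisymm ((mu_le k _).2 (by omega))
        (not_lt.1 (mt (mu_lt k _).1 (by omega))), le_antisymm ((mu_le n _).2 (by omega))
        (not_lt.1 (mt (mu_lt n _).1 (by omega)))⟩⟩
    · right
      rw [hceil] at s2
      rw [hfloor] at s3
      have s1' : Real.sin (α (lam n)) ≠ 0 := mt (sin_massAngle_eq_zero_iff _ _).2 s1
      have hlt : lam n < lam' n := by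
        -- At `lam n` the angle `α` falls short of `τ`, so `α + β` has not yet reached `(n + 1) π`.
        rw [← (hα.strictMono.add hβ.strictMono).lt_iff_lt, elam',
          ← elam]
        have := lt_massAngle (mul_pos (hlam_pos n) hM) s1'
        simp only [hτ]
        linarith
      refine ⟨hlt, ?_, fun k hk => (mu_lt k _).2 (by omega)⟩
      -- If `α` were a multiple of `π` at `lam' n`, the mass would have no effect there and `lam' n`
      -- would equal `lam n`. Otherwise only `n` Dirichlet eigenvalues are at most `lam' n`, so `mu
      -- n` lies beyond it.
      rcases angles_of_add_eq (elam' n) with ⟨t1, t2, t3, t4⟩ | ⟨t1, t2, t3⟩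
      · exfalso
        have : lam n = lam' n := by
          refine hτmono'.injective ?_
          rw [elam, ← elam']
          simp only [hτ, massAngle_of_sin_eq_zero _ t1]
        exact hlt.ne this
      · exact not_le.1 (mt (mu_le n _).1 (by omega))
  refine ⟨lam, lam', mu, hlam, hlam', hmu, ?_, fun n hn => ?_, fun n hn => ?_, ?_⟩
  · rcases alt 0 with ⟨h1, _, _⟩ | ⟨h1, h2, _⟩
    · exact absurd h1 (by norm_num)
    · exact ⟨h1, h2⟩
  · rcases alt (n + 1) with ⟨_, _, h3⟩ | ⟨h1, h2, h3⟩
    · exact absurd ((h3 n rfl).1.trans (h3 n rfl).2.symm) hn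
    · exact ⟨h3 n rfl, h1, h2⟩
  · rcases alt (n + 1) with ⟨_, h2, h3⟩ | ⟨h1, h2, h3⟩
    · exact ⟨(h3 n rfl).1, h2⟩
    · linarith [h3 n rfl]
  · obtain ⟨C₁, hC₁⟩ := hα.asymptotic
    obtain ⟨C₂, hC₂⟩ := hβ.asymptotic
    have hlamtop : Tendsto lam atTop atTop := by
      refine tendsto_atTop_atTop.2 fun x => ?_
      obtain ⟨n, hn⟩ := exists_nat_ge ((τ x + β x) / Real.pi)
      refine ⟨n, fun k hk => ?_⟩
      rw [← hτmono'.le_iff_le, elam]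
      rw [div_le_iff₀ Real.pi_pos] at hn
      have : (n : ℝ) ≤ k := by exact_mod_cast hk
      nlinarith [Real.pi_pos]
    -- `C₁` and `C₂` are the errors of the two angles, and `π` bounds the change of angle at the
    -- mass.
    refine isEquivalent_sq_of_abs_sqrt_sub_le (C := C₁ + C₂ + Real.pi) (add_pos γ₁ γ₂) hlamtop ?_
    filter_upwards [hlamtop.eventually_ge_atTop 1] with n hn
    rw [← elam]
    have b1 := abs_le.1 (hC₁ _ hn)
    have b2 := abs_le.1 (hC₂ _ hn)
    have b3 := abs_le.1 (hτle (lam n))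
    rw [abs_le]
    constructor <;> linarith [b1.1, b1.2, b2.1, b2.2, b3.1, b3.2]
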